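/- **Setting.** Let $A=\{\mathbf a_j\}_{j=1}^m\subseteq\mathbb Z^n$ be linearly independent over $\mathbb R$, and let $\mathbf a_0\in\mathbb Z^n$ lie in the (relative) interior of the convex hull of $A$; equivalently $\ell_0\mathbf a_0=\sum_{j=1}^m\ell_j\mathbf a_j$ with positive integers $\ell_0,\dots,\ell_m$ of greatest common divisor $1$ and $\ell_0=\sum_{j=1}^m\ell_j$. Put $A_+=A\cup\{\mathbf a_0\}$ and $f_\lambda=\sum_{j=1}^m\ell_jx^{\mathbf a_j}-\ell_0\lambda x^{\mathbf a_0}$. Let $M$ be the set of lattice points (points of $\mathbb Z^n$) of the real cone generated by $A$, and let $\mathcal B$ be the set of lattice points of $P(A)=\{\sum_j c_j\mathbf a_j: 0\le c_j<1\}$. For $\mathbf b=\sum_jv_j\mathbf a_j\in\mathcal B$ call $\mathbf b$ interior if all $v_j>0$, and a boundary point otherwise. For a coset $\mathcal C_k$ of $\mathbb ZA_+$ let $M_k=M\cap\mathcal C_k$, $\mathcal B_k=\mathcal B\cap\mathcal C_k$, and let $R_k$ be the number of interior points in $\mathcal B_k$. Let $S'_k$ be the $\mathbb C(\lambda)$-span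 of the monomials $x^u$, $u\in M_k$, and $$\mathcal W'_k=S'_k\Big/\sum_{i=1}^nD_iS'_k,\qquad D_i=x_i\frac{\partial}{\partial x_i}+x_i\frac{\partial f_\lambda}{\partial x_i},$$ on which $\partial_\lambda$ acts as $D_\lambda=\frac{\partial}{\partial\lambda}-\ell_0x^{\mathbf a_0}$. This makes $\mathcal W'_k$ a module over $\mathcal D'=\mathbb C(\lambda)\langle\partial_\lambda\rangle$. **Fundamental solution matrix.** For $\mathbf b'=\sum_jv_j'\mathbf a_j\in\mathcal B$ and $w\in M$ put $g^{(\mathbf b')}_w=\prod_{j=1}^m(-v'_j)(-v'_j-1)\cdots(-v'_j-t_j+1)\,\ell_j^{-t_j}$ if $w=\mathbf b'+\sum_jt_j\mathbf a_j$ with integers $t_j\ge0$, and $g^{(\mathbf b')}_w=0$ otherwise. The fundamental solution matrix has rows and columns indexed by $\mathcal B$, and its $(\mathbf b,\mathbf b')$-entry is $$G^{(\mathbf b')}_{\mathbf b}(\lambda)=\sum_{s\ge0}g^{(\mathbf b')}_{\mathbf b+s\mathbf a_0}\frac{(-\ell_0\lambda)^s}{s!}\in\mathbb C[[\lambda]].$$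 **Hypergeometric operator of a row.** Let $\mathbf b=\sum_jv_j\mathbf a_j\in\mathcal B_k$. Let $T$ be the set of $s\in\{0,\dots,\ell_0-1\}$ such that $\mathbf b+s\mathbf a_0\equiv\mathbf b'\pmod{\mathbb ZA}$ for some boundary point $\mathbf b'\in\mathcal B$ with $\mathbf b'\ne\mathbf b$. Let $(\beta_i)$ be the list of the numbers $1-s/\ell_0$ with $s\in\{0,\dots,\ell_0-1\}\setminus T$, and let $(\alpha_i)$ be the list of all $(v_j+\sigma)/\ell_j$ ($1\le j\le m$, $0\le\sigma<\ell_j$) with one copy of $1-s/\ell_0$ removed for each $s\in T$. Let $L_{\mathbf b}$ be the hypergeometric operator $\prod_i(\delta_x+\beta_i-1)-x\prod_i(\delta_x+\alpha_i)$, $\delta_x=x\frac{d}{dx}$, after the substitution $x=\lambda^{\ell_0}$, that is, $$L_{\mathbf b}=\prod_i\Big(\tfrac1{\ell_0}\lambda\partial_\lambda+\beta_i-1\Big)-\lambda^{\ell_0}\prod_i\Big(\tfrac1{\ell_0}\lambda\partial_\lambda+\alpha_i\Big).$$ **Theorem 8.2.** Let $\mathbf b\in\mathcal B_k$, and let $r$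 be the number of nonzero entries of row $\mathbf b$ of the fundamental solution matrix. 1. These $r$ entries are linearly independent over $\mathbb C$; $r=R_k$ if $\mathbf b$ is interior and $r=R_k+1$ if $\mathbf b$ is a boundary point; and there are exactly $r$ of the $\alpha_i$ and exactly $r$ of the $\beta_i$, so that $L_{\mathbf b}$ has order $r$. 2. The space of solutions of $L_{\mathbf b}y=0$ in $\mathbb C((\lambda))$ is the $\mathbb C$-span of these entries, so that they form a complete set of solutions. 3. The element $x^{\mathbf b}\in\mathcal W'_k$ satisfies this equation: $L_{\mathbf b}\,x^{\mathbf b}=0$ in $\mathcal W'_k$. 4. More generally, if $P\in\mathcal D'$ is any operator whose space of solutions in $\mathbb C((\lambda))$ is the $\mathbb C$-span of these entries, then $P\,x^{\mathbf b}=0$ in $\mathcal W'_k$. -/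

import Mathlib

noncomputable section

namespace Delsarte

/-! ### The field of rational functions in `λ` and its derivation -/

/-- The field `ℂ(λ)`; the indeterminate `λ` is `RatFunc.X`. -/
abbrev K : Type := RatFunc ℂ

/-- The quotient-rule formula for `d/dλ` on `ℂ(λ)`. -/
def ratDerivFun (r : K) : K :=
  (algebraMap (Polynomial ℂ) K (Polynomial.derivative r.num * r.denom
      - r.num * Polynomial.derivative r.denom)) /
    (algebraMap (Polynomial ℂ) K r.denom) ^ 2

theorem quotient_rule_aux {R : Type*} [CommRing R] {n d p q n' d' p' q' : R}
    (h1 : n * q = p * d) (h3 : n' * q + n * q' = p' * d + p * d') :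
    (n' * d - n * d') * q ^ 2 = (p' * q - p * q') * d ^ 2 := by
  linear_combination (q * d) * h3 + (-q' * d - q * d') * h1

theorem ratDerivFun_div (p q : Polynomial ℂ) (hq : q ≠ 0) :
    ratDerivFun (algebraMap (Polynomial ℂ) K p / algebraMap (Polynomial ℂ) K q) =
      (algebraMap (Polynomial ℂ) K (Polynomial.derivative p * q - p * Polynomial.derivative q)) /
        (algebraMap (Polynomial ℂ) K q) ^ 2 := by
  have hq' : algebraMap (Polynomial ℂ) K q ≠ 0 := by simpa using hq
  obtain ⟨r, hr⟩ : ∃ r : K, r = algebraMap (Polynomial ℂ) K p / algebraMap (Polynomial ℂ) K q :=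
    ⟨_, rfl⟩
  rw [← hr]
  have hd' : algebraMap (Polynomial ℂ) K r.denom ≠ 0 := by
    simpa using RatFunc.denom_ne_zero r
  have h1 : r.num * q = p * r.denom := by
    have h2 := (RatFunc.num_div_denom r).trans hr
    rw [div_eq_div_iff hd' hq', ← map_mul, ← map_mul] at h2
    exact RatFunc.algebraMap_injective ℂ h2
  have h3 : Polynomial.derivative r.num * q + r.num * Polynomial.derivative q
      = Polynomial.derivative p * r.denom + p * Polynomial.derivative r.denom := by
    rw [← Polynomial.derivative_mul, ← Polynomial.derivative_mul, h1]
  unfold ratDerivFun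
  rw [div_eq_div_iff (pow_ne_zero 2 hd') (pow_ne_zero 2 hq'), ← map_pow, ← map_pow, ← map_mul,
    ← map_mul, quotient_rule_aux h1 h3]

theorem algebraMap_smul_poly (c : ℂ) (p : Polynomial ℂ) :
    algebraMap (Polynomial ℂ) K (c • p) = c • algebraMap (Polynomial ℂ) K p := by
  rw [Algebra.algebraMap_eq_smul_one, Algebra.algebraMap_eq_smul_one, smul_assoc]

/-- The derivation `d/dλ` of `ℂ(λ)`, as a `ℂ`-linear map. -/
def ratDeriv : K →ₗ[ℂ] K where
  toFun := ratDerivFun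
  map_add' x y := by
    induction x using RatFunc.induction_on with
    | _ p q hq =>
    induction y using RatFunc.induction_on with
    | _ p' q' hq' =>
    have h1 : algebraMap (Polynomial ℂ) K q ≠ 0 := by simpa using hq
    have h2 : algebraMap (Polynomial ℂ) K q' ≠ 0 := by simpa using hq'
    rw [div_add_div _ _ h1 h2, ← map_mul, ← map_mul, ← map_mul, ← map_add,
      ratDerivFun_div _ _ (mul_ne_zero hq hq'), ratDerivFun_div _ _ hq, ratDerivFun_div _ _ hq',
      div_add_div _ _ (pow_ne_zero 2 h1) (pow_ne_zero 2 h2),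
      div_eq_div_iff (pow_ne_zero 2 (by simpa using ⟨hq, hq'⟩))
        (mul_ne_zero (pow_ne_zero 2 h1) (pow_ne_zero 2 h2))]
    simp only [Polynomial.derivative_mul, map_mul, map_sub, map_add]
    ring
  map_smul' c x := by
    induction x using RatFunc.induction_on with
    | _ p q hq =>
    rw [← smul_div_assoc, ← algebraMap_smul_poly, ratDerivFun_div _ _ hq, ratDerivFun_div _ _ hq,
      Polynomial.derivative_smul, smul_mul_assoc, smul_mul_assoc, ← smul_sub, RingHom.id_apply,
      ← smul_div_assoc, algebraMap_smul_poly]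

/-- The Leibniz rule for `d/dλ`. -/
theorem ratDeriv_mul (x y : K) : ratDeriv (x * y) = ratDeriv x * y + x * ratDeriv y := by
  induction x using RatFunc.induction_on with
  | _ p q hq =>
  induction y using RatFunc.induction_on with
  | _ p' q' hq' =>
  have h1 : algebraMap (Polynomial ℂ) K q ≠ 0 := by simpa using hq
  have h2 : algebraMap (Polynomial ℂ) K q' ≠ 0 := by simpa using hq'
  change ratDerivFun _ = ratDerivFun _ * _ + _ * ratDerivFun _
  rw [div_mul_div_comm, ← map_mul, ← map_mul, ratDerivFun_div _ _ (mul_ne_zero hq hq'),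
    ratDerivFun_div _ _ hq, ratDerivFun_div _ _ hq']
  simp only [Polynomial.derivative_mul, map_mul, map_sub, map_add]
  field_simp
  ring

theorem ratDeriv_X : ratDeriv RatFunc.X = 1 := by
  have h := ratDerivFun_div Polynomial.X 1 one_ne_zero
  simpa [ratDeriv] using h

theorem ratDeriv_intCast (z : ℤ) : ratDeriv (z : K) = 0 := by
  have h1 : ratDeriv (1 : K) = 0 := by
    have h := ratDeriv_mul 1 1
    simpa using h
  rw [← zsmul_one, map_zsmul, h1, smul_zero]

/-! ### The combinatorial data -/

/-- The data of a one-parameter monomial deformation of a generalized Delsarte polynomial: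
linearly independent exponent vectors `a j`, and an interior lattice point `a0` of their convex
hull, given through the relation `ℓ0 a0 = ∑ ℓ_j a_j` with positive integers `ℓ0 = ∑ ℓ_j` having
greatest common divisor one. -/
structure Datum (n m : ℕ) where
  a : Fin m → Fin n → ℤ
  a0 : Fin n → ℤ
  ℓ : Fin m → ℕ
  ℓ0 : ℕ
  linearIndependent : LinearIndependent ℝ (fun j => fun i => (a j i : ℝ))
  ℓ_pos : ∀ j, 0 < ℓ j
  ℓ0_pos : 0 < ℓ0
  gcd_eq_one : Nat.gcd ℓ0 (Finset.univ.gcd ℓ) = 1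
  ℓ0_eq_sum : ℓ0 = ∑ j, ℓ j
  relation : ℓ0 • a0 = ∑ j, ℓ j • a j

namespace Datum

variable {n m : ℕ} (D : Datum n m)

/-- `u = ∑ c_j a_j` in `ℝⁿ`. -/
def HasCoords (u : Fin n → ℤ) (c : Fin m → ℝ) : Prop :=
  ∀ i, (u i : ℝ) = ∑ j, c j * (D.a j i : ℝ)

open Classical in
/-- The coordinates of `u` with respect to the `a_j` (unique when they exist, because the `a_j` are
linearly independent; junk value `0` if `u` is not in the real span `V` of the `a_j`). -/
def coord (u : Fin n → ℤ) : Fin m → ℝ :=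
  if h : ∃ c, D.HasCoords u c then h.choose else 0

/-- `M = V_ℤ ∩ C(A)`: the lattice points of the real cone generated by the `a_j`. -/
def M : Set (Fin n → ℤ) := {u | ∃ c, D.HasCoords u c ∧ ∀ j, 0 ≤ c j}

/-- `𝓑 = V_ℤ ∩ P(A)`: the lattice points of the half-open parallelepiped. -/
def B : Set (Fin n → ℤ) := {u | ∃ c, D.HasCoords u c ∧ ∀ j, 0 ≤ c j ∧ c j < 1}

/-- `ℤA`. -/
def latticeA : AddSubgroup (Fin n → ℤ) := AddSubgroup.closure (Set.range D.a)

/-- `ℤA₊`, where `A₊ = A ∪ {a0}`. -/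
def latticeAplus : AddSubgroup (Fin n → ℤ) := AddSubgroup.closure (insert D.a0 (Set.range D.a))

/-- The type of cosets of `ℤA₊` in `ℤⁿ`; the cosets in `V_ℤ` are among these. -/
abbrev Coset : Type := (Fin n → ℤ) ⧸ D.latticeAplus

/-- `M_k`, the part of `M` lying in the coset `k`. -/
def Mk (k : D.Coset) : Set (Fin n → ℤ) := {u | u ∈ D.M ∧ (QuotientAddGroup.mk u : D.Coset) = k}

/-- `𝓑_k`, the part of `𝓑` lying in the coset `k`. -/
def Bk (k : D.Coset) : Set (Fin n → ℤ) := {u | u ∈ D.B ∧ (QuotientAddGroup.mk u : D.Coset) = k}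

/-- A point of `P(A)` is interior (relative to `V`) if all its coordinates are positive, and is a
boundary point otherwise. -/
def IsInterior (u : Fin n → ℤ) : Prop := ∀ j, 0 < D.coord u j

/-- `R_k`, the number of elements of `𝓑_k` that are interior to `P(A)`. -/
def R (k : D.Coset) : ℕ := {u | u ∈ D.Bk k ∧ D.IsInterior u}.ncard

theorem B_subset_M : D.B ⊆ D.M := fun _ ⟨c, hc, h⟩ => ⟨c, hc, fun j => (h j).1⟩

theorem Bk_subset_Mk (k : D.Coset) : D.Bk k ⊆ D.Mk k := fun _ h => ⟨D.B_subset_M h.1, h.2⟩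

/-! ### The differential modules `𝒲'_k` -/

/-- The Laurent polynomial ring `ℂ(λ)[x₁^{±1}, …, xₙ^{±1}]`; `x^u` is `single u 1`. -/
abbrev Laurent (n : ℕ) : Type := AddMonoidAlgebra K (Fin n → ℤ)

/-- The operator `x_i ∂/∂x_i`. -/
def euler (i : Fin n) : Laurent n →ₗ[K] Laurent n :=
  (Finsupp.lsum K fun u : Fin n → ℤ => ((u i : ℤ) : K) • AddMonoidAlgebra.lsingle u) ∘ₗ
    (AddMonoidAlgebra.coeffLinearEquiv K).toLinearMap

/-- The operator `∂/∂λ`, acting on the coefficients. -/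
def dLam : Laurent n →ₗ[ℂ] Laurent n :=
  (AddMonoidAlgebra.coeffLinearEquiv ℂ).symm.toLinearMap ∘ₗ
    Finsupp.mapRange.linearMap ratDeriv ∘ₗ (AddMonoidAlgebra.coeffLinearEquiv ℂ).toLinearMap

/-- `f_λ = ∑ ℓ_j x^{a_j} - ℓ0 λ x^{a0}`. -/
def f : Laurent n :=
  ∑ j, AddMonoidAlgebra.single (D.a j) (D.ℓ j : K)
    - AddMonoidAlgebra.single D.a0 ((D.ℓ0 : K) * RatFunc.X)

/-- `D_i = x_i ∂/∂x_i + x_i ∂f_λ/∂x_i`. -/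
def Di (i : Fin n) : Laurent n →ₗ[K] Laurent n :=
  euler i + LinearMap.mulLeft K (euler i D.f)

/-- `D_λ = ∂/∂λ - ℓ0 x^{a0}`. -/
def Dlam : Laurent n →ₗ[ℂ] Laurent n :=
  dLam - LinearMap.mulLeft ℂ (AddMonoidAlgebra.single D.a0 (D.ℓ0 : K))

theorem euler_single (i : Fin n) (u : Fin n → ℤ) (r : K) :
    euler i (AddMonoidAlgebra.single u r) = AddMonoidAlgebra.single u ((u i : K) * r) := by
  simp [euler]

theorem dLam_single (u : Fin n → ℤ) (r : K) :
    dLam (AddMonoidAlgebra.single u r) = AddMonoidAlgebra.single u (ratDeriv r) := by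
  ext v
  simp [dLam]

theorem euler_f (i : Fin n) : euler i D.f =
    ∑ j, AddMonoidAlgebra.single (D.a j) ((D.a j i : K) * D.ℓ j)
      - AddMonoidAlgebra.single D.a0 ((D.a0 i : K) * ((D.ℓ0 : K) * RatFunc.X)) := by
  simp [f, euler_single, map_sub, map_sum]

theorem Di_single (i : Fin n) (u : Fin n → ℤ) (r : K) :
    D.Di i (AddMonoidAlgebra.single u r) = AddMonoidAlgebra.single u ((u i : K) * r) +
      (∑ j, AddMonoidAlgebra.single (D.a j + u) ((D.a j i : K) * D.ℓ j * r)
        - AddMonoidAlgebra.single (D.a0 + u) ((D.a0 i : K) * ((D.ℓ0 : K) * RatFunc.X) * r)) := by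
  simp [Di, euler_single, euler_f, sub_mul, Finset.sum_mul, AddMonoidAlgebra.single_mul_single]

theorem Dlam_single (u : Fin n → ℤ) (r : K) :
    D.Dlam (AddMonoidAlgebra.single u r) = AddMonoidAlgebra.single u (ratDeriv r)
      - AddMonoidAlgebra.single (D.a0 + u) ((D.ℓ0 : K) * r) := by
  simp [Dlam, dLam_single, AddMonoidAlgebra.single_mul_single]

theorem ratDeriv_const_mul (c : K) (hc : ratDeriv c = 0) (r : K) :
    ratDeriv (c * r) = c * ratDeriv r := by
  rw [ratDeriv_mul, hc, zero_mul, zero_add]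

theorem ratDeriv_natCast (k : ℕ) : ratDeriv (k : K) = 0 := by
  have := ratDeriv_intCast (k : ℤ)
  simpa using this

/-- `D_λ` commutes with the `D_i`. -/
theorem Dlam_Di (i : Fin n) (p : Laurent n) : D.Dlam (D.Di i p) = D.Di i (D.Dlam p) := by
  induction p using AddMonoidAlgebra.induction_linear with
  | zero => simp
  | add p q hp hq => simp only [map_add, hp, hq]
  | single u r =>
    have e1 : ∀ j, ratDeriv ((D.a j i : K) * D.ℓ j * r) = (D.a j i : K) * D.ℓ j * ratDeriv r := by
      intro j
      apply ratDeriv_const_mul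
      rw [ratDeriv_const_mul _ (ratDeriv_intCast _), ratDeriv_natCast, mul_zero]
    have e2 : ratDeriv ((D.a0 i : K) * ((D.ℓ0 : K) * RatFunc.X) * r) =
        (D.a0 i : K) * (D.ℓ0 : K) * r + (D.a0 i : K) * ((D.ℓ0 : K) * RatFunc.X) * ratDeriv r := by
      rw [ratDeriv_mul, ratDeriv_const_mul _ (ratDeriv_intCast _),
        ratDeriv_const_mul _ (ratDeriv_natCast _), ratDeriv_X, mul_one]
    have e3 : ∀ j, D.a0 + (D.a j + u) = D.a j + (D.a0 + u) := fun j => by abel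
    simp only [Di_single, Dlam_single, map_add, map_sub, map_sum, e1, e2,
      ratDeriv_const_mul _ (ratDeriv_intCast _), AddMonoidAlgebra.single_add, e3,
      Pi.add_apply, Int.cast_add, add_mul, Finset.sum_sub_distrib]
    have e4 : ∀ x y z : K, x * (y * z) = y * (x * z) := fun x y z => by ring
    simp only [mul_comm, mul_left_comm, mul_assoc]
    abel

/-- `S'_k`: the `ℂ(λ)`-space spanned by the `x^u` with `u ∈ M_k`. -/
def S (k : D.Coset) : Submodule K (Laurent n) :=
  Submodule.span K ((fun u => AddMonoidAlgebra.single u (1 : K)) '' D.Mk k)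

/-- `∑ D_i S'_k`, as a subspace of `S'_k` (each `D_i` maps `S'_k` to itself). -/
def relations (k : D.Coset) : Submodule K (D.S k) :=
  (⨆ i, (D.S k).map (D.Di i)).comap (D.S k).subtype

/-- `𝒲'_k = S'_k / ∑ D_i S'_k`. -/
abbrev W (k : D.Coset) : Type := D.S k ⧸ D.relations k

/-- The class of `x^u` in `𝒲'_k`, for `u ∈ M_k`. -/
def mono (k : D.Coset) (u : Fin n → ℤ) (hu : u ∈ D.Mk k) : D.W k :=
  Submodule.Quotient.mk ⟨AddMonoidAlgebra.single u 1, Submodule.subset_span ⟨u, hu, rfl⟩⟩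

theorem HasCoords_a0 : D.HasCoords D.a0 (fun j => (D.ℓ j : ℝ) / D.ℓ0) := by
  intro i
  have h := congrFun D.relation i
  have h' : (D.ℓ0 : ℝ) * (D.a0 i : ℝ) = ∑ j, (D.ℓ j : ℝ) * (D.a j i : ℝ) := by
    simp only [Pi.smul_apply, Finset.sum_apply, nsmul_eq_mul] at h
    exact_mod_cast h
  have h0 : (D.ℓ0 : ℝ) ≠ 0 := by exact_mod_cast D.ℓ0_pos.ne'
  have : (D.a0 i : ℝ) = (∑ j, (D.ℓ j : ℝ) * (D.a j i : ℝ)) / D.ℓ0 := by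
    rw [← h']; field_simp
  rw [this, Finset.sum_div]
  exact Finset.sum_congr rfl fun j _ => by ring

theorem HasCoords_a (j : Fin m) : D.HasCoords (D.a j) (fun j' => if j' = j then 1 else 0) := by
  intro i
  simp

theorem add_mem_M {u v : Fin n → ℤ} (hu : u ∈ D.M) (hv : v ∈ D.M) : u + v ∈ D.M := by
  obtain ⟨c, hc, h⟩ := hu
  obtain ⟨c', hc', h'⟩ := hv
  refine ⟨c + c', fun i => ?_, fun j => add_nonneg (h j) (h' j)⟩
  simp [hc i, hc' i, add_mul, Finset.sum_add_distrib]

theorem add_mem_Mk {k : D.Coset} {u v : Fin n → ℤ} (hv : v ∈ D.M) (hv' : v ∈ D.latticeAplus)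
    (hu : u ∈ D.Mk k) : v + u ∈ D.Mk k := by
  refine ⟨D.add_mem_M hv hu.1, ?_⟩
  rw [← hu.2, QuotientAddGroup.mk_add, (QuotientAddGroup.eq_zero_iff v).2 hv', zero_add]

theorem a0_add_mem_Mk {k : D.Coset} {u : Fin n → ℤ} (hu : u ∈ D.Mk k) : D.a0 + u ∈ D.Mk k :=
  D.add_mem_Mk ⟨_, D.HasCoords_a0, fun j => by positivity⟩
    (AddSubgroup.subset_closure (Set.mem_insert _ _)) hu

theorem a_add_mem_Mk {k : D.Coset} {u : Fin n → ℤ} (j : Fin m) (hu : u ∈ D.Mk k) :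
    D.a j + u ∈ D.Mk k :=
  D.add_mem_Mk ⟨_, D.HasCoords_a j, fun j' => by split_ifs <;> norm_num⟩
    (AddSubgroup.subset_closure (Set.mem_insert_of_mem _ ⟨j, rfl⟩)) hu

theorem single_mem_S {k : D.Coset} {u : Fin n → ℤ} (hu : u ∈ D.Mk k) (r : K) :
    AddMonoidAlgebra.single u r ∈ D.S k := by
  have h : (AddMonoidAlgebra.single u r : Laurent n) = r • AddMonoidAlgebra.single u 1 := by simp
  rw [h]
  exact Submodule.smul_mem _ _ (Submodule.subset_span ⟨u, hu, rfl⟩)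

theorem S_induction {k : D.Coset} {P : Laurent n → Prop} (h0 : P 0)
    (hadd : ∀ p q, P p → P q → P (p + q))
    (hs : ∀ u ∈ D.Mk k, ∀ r, P (AddMonoidAlgebra.single u r)) {p : Laurent n} (hp : p ∈ D.S k) :
    P p := by
  rw [S, Submodule.mem_span_set'] at hp
  obtain ⟨N, c, g, rfl⟩ := hp
  refine Finset.sum_induction _ P hadd h0 fun i _ => ?_
  obtain ⟨u, hu, hu'⟩ := (g i).2
  rw [← hu']
  simpa using hs u hu (c i)

theorem Di_mem_S {k : D.Coset} (i : Fin n) {p : Laurent n} (hp : p ∈ D.S k) :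
    D.Di i p ∈ D.S k := by
  refine D.S_induction (P := fun p => D.Di i p ∈ D.S k) ?_ ?_ ?_ hp
  · simp
  · intro p q hp hq
    rw [map_add]
    exact add_mem hp hq
  · intro u hu r
    rw [Di_single]
    exact add_mem (D.single_mem_S hu _) (sub_mem
      (sum_mem fun j _ => D.single_mem_S (D.a_add_mem_Mk j hu) _)
      (D.single_mem_S (D.a0_add_mem_Mk hu) _))

theorem Dlam_mem_S {k : D.Coset} {p : Laurent n} (hp : p ∈ D.S k) : D.Dlam p ∈ D.S k := by
  refine D.S_induction (P := fun p => D.Dlam p ∈ D.S k) ?_ ?_ ?_ hp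
  · simp
  · intro p q hp hq
    rw [map_add]
    exact add_mem hp hq
  · intro u hu r
    rw [Dlam_single]
    exact sub_mem (D.single_mem_S hu _) (D.single_mem_S (D.a0_add_mem_Mk hu) _)

/-- `D_λ` on `S'_k`. -/
def DlamS (k : D.Coset) : D.S k →ₗ[ℂ] D.S k :=
  D.Dlam.restrict (p := (D.S k).restrictScalars ℂ) (q := (D.S k).restrictScalars ℂ)
    fun _ hp => D.Dlam_mem_S hp

theorem Dlam_relations {k : D.Coset} {p : Laurent n} (hp : p ∈ ⨆ i, (D.S k).map (D.Di i)) :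
    D.Dlam p ∈ ⨆ i, (D.S k).map (D.Di i) := by
  induction hp using Submodule.iSup_induction' with
  | mem i x hx =>
    obtain ⟨y, hy, rfl⟩ := hx
    rw [Dlam_Di]
    exact Submodule.mem_iSup_of_mem i ⟨_, D.Dlam_mem_S hy, rfl⟩
  | zero => simp
  | add x y _ _ hx hy => rw [map_add]; exact add_mem hx hy

/-- The action of `∂_λ` on `𝒲'_k`, induced by `D_λ`. -/
def DlamW (k : D.Coset) : D.W k →ₗ[ℂ] D.W k :=
  (Submodule.Quotient.restrictScalarsEquiv ℂ (D.relations k)).toLinearMap ∘ₗ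
    Submodule.mapQ ((D.relations k).restrictScalars ℂ) ((D.relations k).restrictScalars ℂ)
      (D.DlamS k) (fun _ hp => D.Dlam_relations hp) ∘ₗ
    (Submodule.Quotient.restrictScalarsEquiv ℂ (D.relations k)).symm.toLinearMap

theorem DlamW_mk (k : D.Coset) (p : D.S k) :
    D.DlamW k (Submodule.Quotient.mk p) = Submodule.Quotient.mk (D.DlamS k p) := rfl

/-- Multiplication by `λ` on `𝒲'_k`. -/
def lamW (k : D.Coset) : D.W k →ₗ[ℂ] D.W k := Algebra.lsmul ℂ ℂ (D.W k) (RatFunc.X : K)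

/-! ### The fundamental solution matrix -/

/-- `[z]_{-t} = z (z - 1) ⋯ (z - t + 1)` for `t ≥ 0`. -/
def bracketNeg (z : ℂ) (t : ℕ) : ℂ := ∏ i ∈ Finset.range t, (z - i)

open Classical in
/-- The coefficient `g_w^{(b)}` of `x^{-w}` in `g_b`: if `w = b + ∑ t_j a_j` with integers
`t_j ≥ 0` (that is, `-w = ∑ (-v_j + s_j) a_j` with `s_j = -t_j ≤ 0`, where `b = ∑ v_j a_j`), it is
`∏ [-v_j]_{-t_j} ℓ_j^{-t_j}`, and otherwise it is zero. -/
def g (b w : Fin n → ℤ) : ℂ :=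
  if h : ∃ t : Fin m → ℕ, w = b + ∑ j, t j • D.a j then
    ∏ j, (bracketNeg (-(D.coord b j : ℂ)) (h.choose j) * ((D.ℓ j : ℂ) ^ (h.choose j))⁻¹)
  else 0

/-- The coefficient `G_u^{(b)}(λ) = ∑_s g_{u + s a0}^{(b)} (-ℓ0 λ)^s / s!` of `x^{-u}` in the
solution `ξ_b = γ₋(exp(-ℓ0 λ x^{a0}) g_b)`; thus `ξ_b(x^u) = G_u^{(b)}`. -/
def G (b u : Fin n → ℤ) : PowerSeries ℂ :=
  PowerSeries.mk fun s => D.g b (u + s • D.a0) * (-(D.ℓ0 : ℂ)) ^ s / (s.factorial : ℂ)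

/-- The fundamental solution matrix, with `(b, b')`-entry `ξ_{b'}(x^b) = G_b^{(b')}(λ)`. -/
def solMatrix : Matrix D.B D.B (PowerSeries ℂ) := fun b b' => D.G b'.1 b.1

/-- The nonzero entries of row `b` of the fundamental solution matrix, as formal Laurent series. -/
def rowEntries (b : D.B) : {b' : D.B // D.solMatrix b b' ≠ 0} → LaurentSeries ℂ :=
  fun b' => HahnSeries.ofPowerSeries ℤ ℂ (D.solMatrix b b'.1)

/-! ### The hypergeometric parameters -/

open Classical in
/-- The `s ∈ {0, …, ℓ0 - 1}` such that `b + s a0` is congruent modulo `ℤA` to a boundary point `b'`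
of `P(A)` in `𝓑` with `b' ≠ b`; the elements `1 - s / ℓ0` for such `s` are those that cancel. If
`b` is itself interior then `b' ≠ b` holds automatically. -/
def cancelled (b : Fin n → ℤ) : Finset ℕ :=
  (Finset.range D.ℓ0).filter fun s =>
    ∃ b' ∈ D.B, b + s • D.a0 - b' ∈ D.latticeA ∧ ¬ D.IsInterior b' ∧ b' ≠ b

/-- The `β`'s: the elements of the list `1/ℓ0, 2/ℓ0, …, ℓ0/ℓ0`, written as `1 - s/ℓ0` with
`0 ≤ s < ℓ0`, that do not cancel. -/
def beta (b : Fin n → ℤ) : Multiset ℝ :=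
  (Finset.range D.ℓ0 \ D.cancelled b).val.map fun s => 1 - (s : ℝ) / D.ℓ0

/-- The `α`'s: the list of all `(v_j + σ) / ℓ_j`, `0 ≤ σ < ℓ_j`, from which one copy of each
cancelled element has been removed. -/
def alpha (b : Fin n → ℤ) : Multiset ℝ :=
  (∑ j, (Multiset.range (D.ℓ j)).map fun σ => (D.coord b j + (σ : ℝ)) / D.ℓ j)
    - (D.cancelled b).val.map fun s => 1 - (s : ℝ) / D.ℓ0

end Datum

/-! ### Differential operators -/

/-- The hypergeometric operator `∏ (δ + β_i - 1) - x ∏ (δ + α_i)`, for elements `x`, `δ` of an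
algebra of operators. -/
def hypergeometricOp {E : Type*} [Ring E] [Algebra ℂ E] (x δ : E) (α β : Multiset ℝ) : E :=
  Polynomial.aeval δ (β.map fun t => Polynomial.X + Polynomial.C ((t : ℂ) - 1)).prod
    - x * Polynomial.aeval δ (α.map fun t => Polynomial.X + Polynomial.C (t : ℂ)).prod

/-- The hypergeometric operator after the substitution `x = λ^e`, so that
`δ_x = x d/dx = e⁻¹ λ ∂_λ`; here `lam` is multiplication by `λ` and `del` is `∂_λ`. It has leading
term `e^{-r} λ^r (1 - λ^e) ∂_λ^r` if there are `r` of the `α`'s and `r` of the `β`'s. -/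
def hypergeometricOpPow {E : Type*} [Ring E] [Algebra ℂ E] (e : ℕ) (lam del : E)
    (α β : Multiset ℝ) : E :=
  hypergeometricOp (lam ^ e) (((e : ℂ)⁻¹) • (lam * del)) α β

/-- Multiplication by `λ` on `ℂ((λ))`. -/
def lamL : LaurentSeries ℂ →ₗ[ℂ] LaurentSeries ℂ where
  toFun y := HahnSeries.single 1 1 * y
  map_add' x y := mul_add _ x y
  map_smul' c y := by
    rw [← HahnSeries.C_mul_eq_smul, RingHom.id_apply, ← HahnSeries.C_mul_eq_smul, mul_left_comm]

/-- `d/dλ` on `ℂ((λ))`. -/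
def delL : LaurentSeries ℂ →ₗ[ℂ] LaurentSeries ℂ := LaurentSeries.derivative ℂ

open scoped RatFunc in
/-- The embedding `ℂ(λ) → ℂ((λ))`. -/
def toLaurent : K →+* LaurentSeries ℂ := algebraMap (RatFunc ℂ) (LaurentSeries ℂ)

/-- The action on `ℂ((λ))` of the differential operator `∑ c_i(λ) ∂_λ^i` in `ℂ(λ)⟨∂_λ⟩`; an element
of `ℂ(λ)⟨∂_λ⟩` is given here by its (finitely supported) family of coefficients `c_i`. -/
def actL (c : ℕ →₀ K) (y : LaurentSeries ℂ) : LaurentSeries ℂ :=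
  c.sum fun i r => toLaurent r * (delL ^ i) y

/-- The action on `𝒲'_k` of the differential operator `∑ c_i(λ) ∂_λ^i` in `ℂ(λ)⟨∂_λ⟩`. -/
def Datum.actW {n m : ℕ} (D : Datum n m) (k : D.Coset) (c : ℕ →₀ K) (w : D.W k) : D.W k :=
  c.sum fun i r => r • (D.DlamW k ^ i) w

end Delsarte

end

noncomputable section
namespace Delsarte

namespace Datum

/-! Everything is tested against the functionals `xi`, which send `x^u` to `G_u^{(b')}`. They kill
the relations `D_i S'_k` and turn `∂_λ` into `d/dλ` (`xi_Di` type identities come from `G_relation`,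
the other from `delL_G`). They also separate the points of `𝒲'_k` (`eq_zero_of_xi_eq_zero`): the
monomials `x^b`, `b ∈ 𝓑_k`, span `𝒲'_k` (`span_mono_eq_top`), and the solution matrix is the
identity at `λ = 0` (`det_G_ne_zero`). Hence an operator annihilates `x^b` as soon as it annihilates
every entry of row `b`, and the two claims about `𝒲'_k` reduce to claims about power series.

For the row itself: modulo `ℤA`, a point `w ∈ M` has exactly one representative `frac w` in `𝓑`, so
only one `g_w^{(b')}` can be nonzero, namely `gam w`. Since `a0` has order exactly `ℓ0` modulo `ℤA`,
the entries of row `b` cut the single series `∑ rowCoeff b N λ^N` into its residue classes modulo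
`ℓ0`. The relation `ℓ0 a0 = ∑ ℓ_j a_j` makes the quotient of the coefficients at `N + ℓ0` and `N`
rational in `N`: the `(v_j + σ)/ℓ_j` come from the falling factorials, the `1 - s/ℓ0` from the
factorial (`rowCoeff_add`).

For `s < ℓ0` the coefficient at `s` vanishes exactly when `s` is cancelled
(`gam_add_a0_eq_zero_iff`), and then `1 - s/ℓ0` occurs in both lists (`cancelledElements_le`). After
cancellation the indicial roots are exactly the `s` at which some entry starts. A Laurent series
solution is determined by its coefficients there, and there the nonzero entries form a diagonal
matrix without zeros on the diagonal. This gives independence, the solution space and the count. -/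

theorem bracketNeg_add (z : ℂ) (t l : ℕ) :
    bracketNeg z (t + l) = bracketNeg z t * ∏ i ∈ Finset.range l, (z - t - i) := by
  simp only [bracketNeg, Finset.prod_range_add, Nat.cast_add, sub_sub]

/-- The factors are `-(v + i)` with `v ≥ 0`, so only the one with `i = 0` can vanish. -/
theorem bracketNeg_eq_zero_iff {v : ℝ} (hv : 0 ≤ v) (t : ℕ) :
    bracketNeg (-(v : ℂ)) t = 0 ↔ v = 0 ∧ 0 < t := by
  rw [bracketNeg, Finset.prod_eq_zero_iff]
  constructor
  · rintro ⟨i, hi, h⟩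
    have h' : -v - (i : ℝ) = 0 := by exact_mod_cast h
    have hi0 : (0 : ℝ) ≤ i := i.cast_nonneg
    exact ⟨by linarith, by have := Finset.mem_range.1 hi; omega⟩
  · rintro ⟨rfl, h⟩
    exact ⟨0, Finset.mem_range.2 h, by simp⟩

variable {n m : ℕ} (D : Datum n m)

/-! ### Coordinates -/

variable {D}

theorem HasCoords.unique {u : Fin n → ℤ} {c d : Fin m → ℝ} (hc : D.HasCoords u c)
    (hd : D.HasCoords u d) : c = d := by
  have h := Fintype.linearIndependent_iff.1 D.linearIndependent (c - d) (by
    ext i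
    have h1 := (hc i).symm.trans (hd i)
    simp [sub_mul, Finset.sum_sub_distrib, h1])
  ext j
  exact sub_eq_zero.1 (h j)

theorem HasCoords.coord_eq {u : Fin n → ℤ} {c : Fin m → ℝ} (hc : D.HasCoords u c) :
    D.coord u = c := by
  have h : ∃ c, D.HasCoords u c := ⟨c, hc⟩
  rw [coord, dif_pos h]
  exact h.choose_spec.unique hc

theorem HasCoords.add {u v : Fin n → ℤ} {c d : Fin m → ℝ} (hu : D.HasCoords u c)
    (hv : D.HasCoords v d) : D.HasCoords (u + v) (c + d) := fun i => by
  simp [hu i, hv i, add_mul, Finset.sum_add_distrib]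

theorem HasCoords.zsmul {u : Fin n → ℤ} {c : Fin m → ℝ} (z : ℤ) (hu : D.HasCoords u c) :
    D.HasCoords (z • u) ((z : ℝ) • c) := fun i => by
  simp [hu i, Finset.mul_sum, mul_assoc]

theorem HasCoords.nsmul {u : Fin n → ℤ} {c : Fin m → ℝ} (z : ℕ) (hu : D.HasCoords u c) :
    D.HasCoords (z • u) ((z : ℝ) • c) := fun i => by
  simp [hu i, Finset.mul_sum, mul_assoc]

theorem HasCoords.sub {u v : Fin n → ℤ} {c d : Fin m → ℝ} (hu : D.HasCoords u c)
    (hv : D.HasCoords v d) : D.HasCoords (u - v) (c - d) := fun i => by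
  simp [hu i, hv i, sub_mul, Finset.sum_sub_distrib]

variable (D)

theorem hasCoords_sum_zsmul (z : Fin m → ℤ) :
    D.HasCoords (∑ j, z j • D.a j) (fun j => (z j : ℝ)) := fun i => by
  simp [Finset.sum_apply]

theorem hasCoords_sum_nsmul (t : Fin m → ℕ) :
    D.HasCoords (∑ j, t j • D.a j) (fun j => (t j : ℝ)) := fun i => by
  simp [Finset.sum_apply]

variable {D} in
theorem hasCoords_coord {u : Fin n → ℤ} (hu : u ∈ D.M) : D.HasCoords u (D.coord u) := by
  obtain ⟨c, hc, -⟩ := hu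
  rwa [hc.coord_eq]

variable {D} in
theorem coord_nonneg {u : Fin n → ℤ} (hu : u ∈ D.M) (j : Fin m) : 0 ≤ D.coord u j := by
  obtain ⟨c, hc, h⟩ := hu
  rw [hc.coord_eq]
  exact h j

variable {D} in
theorem coord_lt_one {u : Fin n → ℤ} (hu : u ∈ D.B) (j : Fin m) : D.coord u j < 1 := by
  obtain ⟨c, hc, h⟩ := hu
  rw [hc.coord_eq]
  exact (h j).2

theorem a_mem_M (j : Fin m) : D.a j ∈ D.M :=
  ⟨_, D.HasCoords_a j, fun j' => by split_ifs <;> norm_num⟩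

theorem a0_mem_M : D.a0 ∈ D.M := ⟨_, D.HasCoords_a0, fun j => by positivity⟩

theorem nsmul_mem_M {u : Fin n → ℤ} (hu : u ∈ D.M) (s : ℕ) : s • u ∈ D.M :=
  ⟨_, (hasCoords_coord hu).nsmul s, fun j => mul_nonneg s.cast_nonneg (coord_nonneg hu j)⟩

variable {D} in
theorem add_nsmul_a0_mem_M {u : Fin n → ℤ} (hu : u ∈ D.M) (s : ℕ) : u + s • D.a0 ∈ D.M :=
  D.add_mem_M hu (D.nsmul_mem_M D.a0_mem_M s)

variable {D} in
theorem coord_add_a0 {u : Fin n → ℤ} (hu : u ∈ D.M) (s : ℕ) (j : Fin m) :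
    D.coord (u + s • D.a0) j = D.coord u j + s * (D.ℓ j / D.ℓ0) := by
  rw [((hasCoords_coord hu).add (D.HasCoords_a0.nsmul s)).coord_eq]
  rfl

variable {D} in
theorem coord_add_sum {u : Fin n → ℤ} (hu : u ∈ D.M) (t : Fin m → ℕ) :
    D.coord (u + ∑ j, t j • D.a j) = D.coord u + fun j => (t j : ℝ) := by
  rw [((hasCoords_coord hu).add (D.hasCoords_sum_nsmul t)).coord_eq]

/-! ### Reduction of lattice points modulo `ℤA` -/

/-- The integer parts of the coordinates. -/
def floorVec (u : Fin n → ℤ) (j : Fin m) : ℕ := ⌊D.coord u j⌋₊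

/-- The representative of `u` modulo `ℤA` in the half-open parallelepiped. -/
def frac (u : Fin n → ℤ) : Fin n → ℤ := u - ∑ j, D.floorVec u j • D.a j

theorem frac_add (u : Fin n → ℤ) : D.frac u + ∑ j, D.floorVec u j • D.a j = u := by
  simp [frac]

variable {D}

theorem frac_mem_B {u : Fin n → ℤ} (hu : u ∈ D.M) : D.frac u ∈ D.B := by
  refine ⟨_, (hasCoords_coord hu).sub (D.hasCoords_sum_nsmul _), fun j => ?_⟩
  have h1 := Nat.floor_le (coord_nonneg hu j)
  have h2 := Nat.lt_floor_add_one (D.coord u j)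
  simp only [Pi.sub_apply, floorVec]
  constructor <;> linarith

theorem coord_frac {u : Fin n → ℤ} (hu : u ∈ D.M) (j : Fin m) :
    D.coord (D.frac u) j = D.coord u j - D.floorVec u j := by
  rw [frac, ((hasCoords_coord hu).sub (D.hasCoords_sum_nsmul _)).coord_eq]
  rfl

theorem floorVec_add_sum {u : Fin n → ℤ} (hu : u ∈ D.M) (t : Fin m → ℕ) :
    D.floorVec (u + ∑ j, t j • D.a j) = D.floorVec u + t := by
  ext j
  rw [floorVec, coord_add_sum hu]
  exact Nat.floor_add_natCast (coord_nonneg hu j) _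

theorem frac_add_sum {u : Fin n → ℤ} (hu : u ∈ D.M) (t : Fin m → ℕ) :
    D.frac (u + ∑ j, t j • D.a j) = D.frac u := by
  rw [frac, frac, floorVec_add_sum hu]
  simp [add_smul, Finset.sum_add_distrib]

theorem floorVec_eq_zero {b : Fin n → ℤ} (hb : b ∈ D.B) : D.floorVec b = 0 := by
  ext j
  exact Nat.floor_eq_zero.2 (coord_lt_one hb j)

theorem frac_eq_self {b : Fin n → ℤ} (hb : b ∈ D.B) : D.frac b = b := by
  simp [frac, floorVec_eq_zero hb]

theorem sum_single_nsmul (j : Fin m) : ∑ i, (Pi.single j 1 : Fin m → ℕ) i • D.a i = D.a j := by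
  rw [Finset.sum_eq_single j] <;> simp +contextual

variable (D) in
theorem mem_latticeA {x : Fin n → ℤ} : x ∈ D.latticeA ↔ ∃ z : Fin m → ℤ, x = ∑ j, z j • D.a j := by
  rw [latticeA, ← Submodule.span_int_eq_addSubgroupClosure, Submodule.mem_toAddSubgroup,
    Submodule.mem_span_range_iff_exists_fun]
  simp [eq_comm]

/-- The coordinates of `b` lie in `[0, 1)`, so an integral difference of coordinates must be the
vector of integer parts of `u`. -/
theorem sub_mem_latticeA_iff {u b : Fin n → ℤ} (hu : u ∈ D.M) (hb : b ∈ D.B) :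
    u - b ∈ D.latticeA ↔ b = D.frac u := by
  constructor
  · intro h
    obtain ⟨z, hz⟩ := D.mem_latticeA.1 h
    have h1 : D.HasCoords u (D.coord b + fun j => (z j : ℝ)) := by
      rw [← sub_add_cancel u b, hz, add_comm]
      exact (hasCoords_coord (D.B_subset_M hb)).add (D.hasCoords_sum_zsmul z)
    have hz' : ∀ j, z j = D.floorVec u j := fun j => by
      have e := congrFun h1.coord_eq j
      simp only [Pi.add_apply] at e
      rw [floorVec, Int.natCast_floor_eq_floor (coord_nonneg hu j), e, Int.floor_add_intCast,
        Int.floor_eq_zero_iff.2 ⟨coord_nonneg (D.B_subset_M hb) j, coord_lt_one hb j⟩, zero_add]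
    rw [frac, eq_sub_iff_add_eq, ← eq_sub_iff_add_eq', hz]
    simp [hz']
  · rintro rfl
    rw [D.mem_latticeA]
    exact ⟨fun j => D.floorVec u j, by simp [frac]⟩

theorem frac_eq_frac_iff {u v : Fin n → ℤ} (hu : u ∈ D.M) (hv : v ∈ D.M) :
    D.frac u = D.frac v ↔ u - v ∈ D.latticeA := by
  have h : v - D.frac v ∈ D.latticeA := (sub_mem_latticeA_iff hv (frac_mem_B hv)).2 rfl
  rw [eq_comm, ← sub_mem_latticeA_iff hu (frac_mem_B hv), ← sub_add_sub_cancel u v,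
    AddSubgroup.add_mem_cancel_right _ h]

variable (D) in
theorem latticeA_le : D.latticeA ≤ D.latticeAplus :=
  AddSubgroup.closure_mono (Set.subset_insert _ _)

theorem frac_mem_Bk {k : D.Coset} {u : Fin n → ℤ} (hu : u ∈ D.Mk k) : D.frac u ∈ D.Bk k := by
  refine ⟨frac_mem_B hu.1, ?_⟩
  rw [← hu.2, QuotientAddGroup.eq, neg_add_eq_sub]
  exact D.latticeA_le ((sub_mem_latticeA_iff hu.1 (frac_mem_B hu.1)).2 rfl)

theorem add_nsmul_a0_mem_Mk {k : D.Coset} {u : Fin n → ℤ} (hu : u ∈ D.Mk k) (s : ℕ) :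
    u + s • D.a0 ∈ D.Mk k := by
  rw [add_comm]
  exact D.add_mem_Mk (D.nsmul_mem_M D.a0_mem_M s)
    (nsmul_mem (AddSubgroup.subset_closure (Set.mem_insert _ _)) s) hu

variable (D) in
-- Membership means that all `z ℓ_j / ℓ0` are integers; as `ℓ0` is prime to the gcd of the `ℓ_j`,
-- this forces `ℓ0 ∣ z`. So `a0` has order exactly `ℓ0` modulo `ℤA`.
theorem zsmul_a0_mem_latticeA (z : ℤ) : z • D.a0 ∈ D.latticeA ↔ (D.ℓ0 : ℤ) ∣ z := by
  have h0 : (D.ℓ0 : ℝ) ≠ 0 := by exact_mod_cast D.ℓ0_pos.ne'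
  constructor
  · intro h
    obtain ⟨y, hy⟩ := D.mem_latticeA.1 h
    have h1 := (D.HasCoords_a0.zsmul z).unique (hy ▸ D.hasCoords_sum_zsmul y)
    have h2 : ∀ j, z * D.ℓ j = D.ℓ0 * y j := fun j => by
      have := congrFun h1 j
      simp only [Pi.smul_apply, smul_eq_mul] at this
      field_simp at this
      exact_mod_cast this
    have h3 : D.ℓ0 ∣ z.natAbs * Finset.univ.gcd D.ℓ := by
      rw [← normalize_eq z.natAbs, ← Finset.gcd_mul_left]
      refine Finset.dvd_gcd fun j _ => ?_
      have := Int.natAbs_dvd_natAbs.2 (⟨_, h2 j⟩ : (D.ℓ0 : ℤ) ∣ z * D.ℓ j)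
      simpa [Int.natAbs_mul] using this
    exact Int.natCast_dvd.2 (Nat.Coprime.dvd_of_dvd_mul_right D.gcd_eq_one h3)
  · rintro ⟨y, rfl⟩
    rw [mul_comm, mul_smul, natCast_zsmul, D.relation]
    exact zsmul_mem (sum_mem fun j _ => nsmul_mem (AddSubgroup.subset_closure (Set.mem_range_self j)) _) _

theorem frac_add_a0_eq_iff {u : Fin n → ℤ} (hu : u ∈ D.M) (s t : ℕ) :
    D.frac (u + s • D.a0) = D.frac (u + t • D.a0) ↔ s ≡ t [MOD D.ℓ0] := by
  rw [frac_eq_frac_iff (add_nsmul_a0_mem_M hu s) (add_nsmul_a0_mem_M hu t), add_sub_add_left_eq_sub,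
    ← natCast_zsmul, ← natCast_zsmul, ← sub_smul, D.zsmul_a0_mem_latticeA,
    ← Int.natCast_modEq_iff, Int.modEq_comm, Int.modEq_iff_dvd]

/-- `ℤA₊ = ℤa0 + ℤA`, and the multiple of `a0` only matters modulo `ℓ0`. With `frac_add_a0_eq_iff`,
this indexes `𝓑_k` bijectively by `{0, …, ℓ0 - 1}`. -/
theorem exists_frac_add_a0_eq {k : D.Coset} {b b' : Fin n → ℤ} (hb : b ∈ D.Mk k)
    (hb' : b' ∈ D.Bk k) : ∃ s < D.ℓ0, D.frac (b + s • D.a0) = b' := by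
  have h : -b + b' ∈ D.latticeAplus := QuotientAddGroup.eq.1 (hb.2.trans hb'.2.symm)
  rw [latticeAplus, Set.insert_eq, AddSubgroup.closure_union, AddSubgroup.mem_sup] at h
  obtain ⟨y, hy, x, hx, e⟩ := h
  obtain ⟨z, rfl⟩ := AddSubgroup.mem_closure_singleton.1 hy
  have h0 : (0 : ℤ) < D.ℓ0 := by exact_mod_cast D.ℓ0_pos
  have hz := Int.emod_nonneg z h0.ne'
  have hz' := Int.emod_lt_of_pos z h0
  refine ⟨(z % D.ℓ0).toNat, by omega, ?_⟩
  rw [eq_comm, ← sub_mem_latticeA_iff (add_nsmul_a0_mem_M hb.1 _) hb'.1]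
  have e2 : b + (z % D.ℓ0).toNat • D.a0 - b' = (z % D.ℓ0 - z) • D.a0 - x := by
    rw [sub_smul, ← natCast_zsmul, Int.toNat_of_nonneg hz]
    have : b' = b + (z • D.a0 + x) := by rw [e]; abel
    rw [this]; abel
  rw [e2]
  refine sub_mem ((D.zsmul_a0_mem_latticeA _).2 ?_) hx
  exact (Int.modEq_iff_dvd.1 (Int.mod_modEq z D.ℓ0).symm)

/-! ### The coefficients `g` -/

variable (D) in
/-- The only coefficient `g_w^{(b)}`, `b ∈ 𝓑`, that can be nonzero. -/
def gam (w : Fin n → ℤ) : ℂ :=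
  ∏ j, (bracketNeg (-(D.coord (D.frac w) j : ℂ)) (D.floorVec w j) *
    ((D.ℓ j : ℂ) ^ (D.floorVec w j))⁻¹)

open Classical in
theorem g_eq {b w : Fin n → ℤ} (hb : b ∈ D.B) (hw : w ∈ D.M) :
    D.g b w = if b = D.frac w then D.gam w else 0 := by
  -- The exponents `t` are unique, so the choice made in `g` is forced.
  have key : ∀ t : Fin m → ℕ, w = b + ∑ j, t j • D.a j → b = D.frac w ∧ t = D.floorVec w := by
    rintro t rfl
    rw [frac_add_sum (D.B_subset_M hb), frac_eq_self hb, floorVec_add_sum (D.B_subset_M hb),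
      floorVec_eq_zero hb, zero_add]
    exact ⟨rfl, rfl⟩
  rw [g]
  split_ifs with h h1 h1
  · have := (key _ h.choose_spec).2
    rw [this, gam, ← h1]
  · exact absurd (key _ h.choose_spec).1 h1
  · exact absurd ⟨D.floorVec w, by rw [h1, frac_add]⟩ h
  · rfl

/-- Adding `∑ t_j a_j` keeps the fractional part and lengthens each falling factorial; fractional
plus integer part recombine into the coordinate of `u`. The case of a single `a_j` gives the
differential relations, the case `t = ℓ` the hypergeometric recursion. -/
theorem gam_add_sum {u : Fin n → ℤ} (hu : u ∈ D.M) (t : Fin m → ℕ) :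
    D.gam (u + ∑ j, t j • D.a j) = D.gam u *
      ∏ j, ∏ i ∈ Finset.range (t j), (-(D.coord u j + i : ℂ) / D.ℓ j) := by
  rw [gam, gam, frac_add_sum hu, floorVec_add_sum hu, ← Finset.prod_mul_distrib]
  refine Finset.prod_congr rfl fun j _ => ?_
  have h : (D.coord (D.frac u) j : ℂ) = D.coord u j - D.floorVec u j := by
    rw [coord_frac hu]; simp
  have h' : ∀ i : ℕ, -((D.coord u j : ℂ) - D.floorVec u j) - D.floorVec u j - i =
    -(D.coord u j + i : ℂ) := fun i => by ring
  rw [Pi.add_apply, bracketNeg_add, pow_add, mul_inv, Finset.prod_div_distrib, Finset.prod_const,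
    Finset.card_range, div_eq_mul_inv, h]
  simp only [h']
  ring

theorem gam_add_a {u : Fin n → ℤ} (hu : u ∈ D.M) (j : Fin m) :
    D.ℓ j * D.gam (u + D.a j) = -(D.coord u j : ℂ) * D.gam u := by
  have h := gam_add_sum hu (Pi.single j 1)
  rw [sum_single_nsmul, Finset.prod_eq_single j] at h
  · have h0 : (D.ℓ j : ℂ) ≠ 0 := by exact_mod_cast (D.ℓ_pos j).ne'
    rw [h]
    simp
    field_simp
  · intro i _ hi
    simp [hi]
  · simp

theorem gam_eq_zero_iff {w : Fin n → ℤ} (hw : w ∈ D.M) :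
    D.gam w = 0 ↔ ∃ j, D.coord (D.frac w) j = 0 ∧ 0 < D.floorVec w j := by
  rw [gam, Finset.prod_eq_zero_iff]
  simp only [Finset.mem_univ, true_and]
  refine exists_congr fun j => ?_
  have h0 : (D.ℓ j : ℂ) ≠ 0 := by exact_mod_cast (D.ℓ_pos j).ne'
  rw [mul_eq_zero, or_iff_left (inv_ne_zero (pow_ne_zero _ h0)),
    bracketNeg_eq_zero_iff (coord_nonneg (D.B_subset_M (frac_mem_B hw)) j)]

open Classical in
theorem mem_cancelled_iff {b : Fin n → ℤ} (hb : b ∈ D.B) (s : ℕ) : s ∈ D.cancelled b ↔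
    s < D.ℓ0 ∧ ¬ D.IsInterior (D.frac (b + s • D.a0)) ∧ D.frac (b + s • D.a0) ≠ b := by
  have hM := add_nsmul_a0_mem_M (D.B_subset_M hb) s
  rw [cancelled, Finset.mem_filter, Finset.mem_range]
  refine and_congr_right fun _ => ⟨?_, fun h => ⟨_, frac_mem_B hM, ?_, h⟩⟩
  · rintro ⟨b', hb', h, h'⟩
    rwa [(sub_mem_latticeA_iff hM hb').1 h] at h'
  · exact (sub_mem_latticeA_iff hM (frac_mem_B hM)).2 rfl

theorem frac_add_a0_eq_self_iff {b : Fin n → ℤ} (hb : b ∈ D.B) {s : ℕ} (hs : s < D.ℓ0) :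
    D.frac (b + s • D.a0) = b ↔ s = 0 := by
  have h := frac_add_a0_eq_iff (D.B_subset_M hb) s 0
  rw [zero_smul, add_zero, frac_eq_self hb] at h
  rw [h, Nat.ModEq, Nat.mod_eq_of_lt hs, Nat.zero_mod]

theorem exists_coord_eq_zero {b : Fin n → ℤ} (hb : b ∈ D.B) (h : ¬ D.IsInterior b) :
    ∃ j, D.coord b j = 0 := by
  rw [IsInterior, not_forall] at h
  obtain ⟨j, hj⟩ := h
  exact ⟨j, le_antisymm (not_lt.1 hj) (coord_nonneg (D.B_subset_M hb) j)⟩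

/-- If the reduced point has a zero coordinate, the unreduced one, `v_j + s ℓ_j / ℓ0`, is an
integer, positive when `s > 0`; the falling factorial of `0` is then nonempty and vanishes. At `s =
0` nothing has been reduced, which is why `b` itself never cancels. -/
theorem gam_add_a0_eq_zero_iff {b : Fin n → ℤ} (hb : b ∈ D.B) {s : ℕ} (hs : s < D.ℓ0) :
    D.gam (b + s • D.a0) = 0 ↔ s ∈ D.cancelled b := by
  have hM := add_nsmul_a0_mem_M (D.B_subset_M hb) s
  rw [gam_eq_zero_iff hM, mem_cancelled_iff hb, Ne, frac_add_a0_eq_self_iff hb hs]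
  constructor
  · rintro ⟨j, h1, h2⟩
    refine ⟨hs, fun h => (h j).ne' h1, ?_⟩
    rintro rfl
    rw [zero_smul, add_zero, floorVec_eq_zero hb] at h2
    exact h2.ne rfl
  · rintro ⟨-, h1, h2⟩
    obtain ⟨j, hj⟩ := exists_coord_eq_zero (frac_mem_B hM) h1
    refine ⟨j, hj, ?_⟩
    rw [coord_frac hM, coord_add_a0 (D.B_subset_M hb), sub_eq_zero] at hj
    have h3 := coord_nonneg (D.B_subset_M hb) j
    have h4 : 0 < (s : ℝ) * (D.ℓ j / D.ℓ0) := by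
      have := D.ℓ_pos j
      have := D.ℓ0_pos
      have := Nat.pos_of_ne_zero h2
      positivity
    have h5 : (0 : ℝ) < D.floorVec (b + s • D.a0) j := by linarith
    exact_mod_cast h5

end Datum

open scoped RatFunc

/-! ### The differential field `ℂ((λ))` -/

theorem delL_coeff (y : LaurentSeries ℂ) (N : ℤ) :
    (delL y).coeff N = ((N : ℂ) + 1) * y.coeff (N + 1) := by
  simp [delL]

theorem lamL_coeff (y : LaurentSeries ℂ) (N : ℤ) : (lamL y).coeff N = y.coeff (N - 1) := by
  have := HahnSeries.coeff_single_mul_add (r := (1 : ℂ)) (x := y) (a := N - 1) (b := 1)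
  simpa [lamL] using this

theorem toLaurent_C (c : ℂ) :
    toLaurent (algebraMap (Polynomial ℂ) K (Polynomial.C c)) = HahnSeries.C c := by
  rw [toLaurent, ← IsScalarTower.algebraMap_apply (Polynomial ℂ) K (LaurentSeries ℂ)]
  simp [Polynomial.algebraMap_hahnSeries_apply]

theorem toLaurent_X : toLaurent RatFunc.X = HahnSeries.single 1 1 := by
  simp [toLaurent]

theorem ratDeriv_algebraMap (p : Polynomial ℂ) :
    ratDeriv (algebraMap (Polynomial ℂ) K p) =
      algebraMap (Polynomial ℂ) K (Polynomial.derivative p) := by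
  have h := ratDerivFun_div p 1 one_ne_zero
  simpa [ratDeriv] using h

theorem delL_toLaurent_algebraMap_mul (p : Polynomial ℂ) (y : LaurentSeries ℂ) :
    delL (toLaurent (algebraMap (Polynomial ℂ) K p) * y) =
      toLaurent (ratDeriv (algebraMap (Polynomial ℂ) K p)) * y +
        toLaurent (algebraMap (Polynomial ℂ) K p) * delL y := by
  induction p using Polynomial.induction_on generalizing y with
  | C c =>
    rw [ratDeriv_algebraMap, Polynomial.derivative_C, map_zero, map_zero, zero_mul, zero_add,
      toLaurent_C, HahnSeries.C_mul_eq_smul, HahnSeries.C_mul_eq_smul, map_smul]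
  | add p q hp hq => simp only [map_add, add_mul, hp, hq]; ring
  | monomial k c h =>
    have hX : ∀ z : LaurentSeries ℂ, delL (toLaurent RatFunc.X * z) =
        z + toLaurent RatFunc.X * delL z := fun z => by
      rw [toLaurent_X]
      ext N
      have e1 := lamL_coeff z (N + 1)
      have e2 := lamL_coeff (delL z) N
      simp only [lamL, LinearMap.coe_mk, AddHom.coe_mk] at e1 e2
      rw [delL_coeff, e1, HahnSeries.coeff_add, e2, delL_coeff]
      simp only [add_sub_cancel_right, sub_add_cancel]
      push_cast
      ring
    have e : algebraMap (Polynomial ℂ) K (Polynomial.C c * Polynomial.X ^ (k + 1)) =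
        algebraMap (Polynomial ℂ) K (Polynomial.C c * Polynomial.X ^ k) * RatFunc.X := by
      rw [pow_succ, ← mul_assoc, map_mul, RatFunc.algebraMap_X]
    rw [e, ratDeriv_mul, ratDeriv_X, map_mul toLaurent, map_add, map_mul toLaurent, mul_one, mul_assoc,
      h, hX]
    ring

theorem delL_toLaurent_mul (r : K) (y : LaurentSeries ℂ) :
    delL (toLaurent r * y) = toLaurent (ratDeriv r) * y + toLaurent r * delL y := by
  induction r using RatFunc.induction_on with
  | _ p q hq =>
  have hq' : algebraMap (Polynomial ℂ) K q ≠ 0 := by simpa using hq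
  obtain ⟨r, hr⟩ : ∃ r : K, r = algebraMap (Polynomial ℂ) K p / algebraMap (Polynomial ℂ) K q :=
    ⟨_, rfl⟩
  rw [← hr]
  have hp : algebraMap (Polynomial ℂ) K p = algebraMap (Polynomial ℂ) K q * r := by
    rw [hr]; field_simp
  -- With `p = q r`, the Leibniz rule for the polynomials `q` and `p` is compared on `q · (r y) = p
  -- · y`, and `q` is cancelled.
  have h1 := delL_toLaurent_algebraMap_mul q (toLaurent r * y)
  have h2 := delL_toLaurent_algebraMap_mul p y
  rw [hp, ratDeriv_mul, map_mul toLaurent, map_add, map_mul toLaurent, map_mul toLaurent, mul_assoc,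
    h1] at h2
  have h3 : toLaurent (algebraMap (Polynomial ℂ) K q) ≠ 0 := by
    rwa [Ne, map_eq_zero]
  apply mul_left_cancel₀ h3
  linear_combination h2

namespace Datum

variable {n m : ℕ} {D : Datum n m}

/-! ### The solutions `ξ_b` -/

open Classical in
theorem coeff_G {b u : Fin n → ℤ} (hb : b ∈ D.B) (hu : u ∈ D.M) (s : ℕ) :
    PowerSeries.coeff s (D.G b u) = if b = D.frac (u + s • D.a0) then
      D.gam (u + s • D.a0) * (-(D.ℓ0 : ℂ)) ^ s / s.factorial else 0 := by
  rw [G, PowerSeries.coeff_mk, g_eq hb (add_nsmul_a0_mem_M hu s)]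
  split_ifs <;> simp

theorem frac_add_a {u : Fin n → ℤ} (hu : u ∈ D.M) (j : Fin m) : D.frac (u + D.a j) = D.frac u := by
  rw [← frac_add_sum hu (Pi.single j 1), sum_single_nsmul]

theorem neg_pow_succ_div_factorial (s : ℕ) :
    (-(D.ℓ0 : ℂ)) ^ (s + 1) / (s + 1).factorial * (s + 1) =
      -(D.ℓ0 : ℂ) * ((-(D.ℓ0 : ℂ)) ^ s / s.factorial) := by
  have h : ((s + 1 : ℕ) : ℂ) ≠ 0 := by exact_mod_cast s.succ_ne_zero
  have h' : (s.factorial : ℂ) ≠ 0 := by exact_mod_cast s.factorial_ne_zero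
  rw [Nat.factorial_succ, pow_succ]
  push_cast at h ⊢
  field_simp

theorem delL_G {b u : Fin n → ℤ} (hb : b ∈ D.B) (hu : u ∈ D.M) :
    PowerSeries.derivative ℂ (D.G b u) = PowerSeries.C (-(D.ℓ0 : ℂ)) * D.G b (D.a0 + u) := by
  ext s
  have e : D.a0 + u + s • D.a0 = u + (s + 1) • D.a0 := by rw [succ_nsmul]; abel
  rw [PowerSeries.coeff_derivative, PowerSeries.coeff_C_mul, coeff_G hb hu,
    coeff_G hb (D.add_mem_M D.a0_mem_M hu), e]
  split_ifs
  · rw [mul_div_assoc, mul_assoc, neg_pow_succ_div_factorial]; ring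
  · simp

/-- Coefficientwise this is `gam_add_a` at `u + s a0`, whose `j`-th coordinate is that of `u` plus
`s ℓ_j / ℓ0`; the second summand produces the term with `λ`. -/
theorem G_relation {b u : Fin n → ℤ} (hb : b ∈ D.B) (hu : u ∈ D.M) (j : Fin m) :
    PowerSeries.C (D.coord u j : ℂ) * D.G b u + PowerSeries.C (D.ℓ j : ℂ) * D.G b (D.a j + u) =
      PowerSeries.C (D.ℓ j : ℂ) * (PowerSeries.X * D.G b (D.a0 + u)) := by
  have h0 : (D.ℓ0 : ℂ) ≠ 0 := by exact_mod_cast D.ℓ0_pos.ne'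
  -- By `delL_G`, `λ G_{a0+u} = -ℓ0⁻¹ λ d/dλ G_u`.
  have h1 : ∀ s : ℕ, PowerSeries.coeff s (PowerSeries.X * D.G b (D.a0 + u)) =
      -(s : ℂ) / D.ℓ0 * PowerSeries.coeff s (D.G b u) := by
    rintro (_ | s)
    · simp
    · have h2 := congrArg (PowerSeries.coeff s) (delL_G hb hu)
      rw [PowerSeries.coeff_derivative, PowerSeries.coeff_C_mul] at h2
      rw [PowerSeries.coeff_succ_X_mul]
      push_cast
      field_simp
      linear_combination h2
  ext s
  have hM := add_nsmul_a0_mem_M hu s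
  have e : D.a j + u + s • D.a0 = u + s • D.a0 + D.a j := by abel
  have h3 := gam_add_a hM j
  rw [coord_add_a0 hu] at h3
  rw [map_add, PowerSeries.coeff_C_mul, PowerSeries.coeff_C_mul, PowerSeries.coeff_C_mul, h1,
    coeff_G hb hu, coeff_G hb (D.add_mem_M (D.a_mem_M j) hu), e, frac_add_a hM]
  split_ifs
  · have h4 : (D.ℓ j : ℂ) * (D.gam (u + s • D.a0 + D.a j) * (-(D.ℓ0 : ℂ)) ^ s / s.factorial) =
        -((D.coord u j + s * (D.ℓ j / D.ℓ0) : ℝ) : ℂ) *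
          (D.gam (u + s • D.a0) * (-(D.ℓ0 : ℂ)) ^ s / s.factorial) := by
      rw [mul_div_assoc, ← mul_assoc, h3]; ring
    rw [h4]
    push_cast
    ring
  · simp

variable (D) in
/-- The functional `x^u ↦ G_u^{(b)}` on Laurent polynomials. -/
def xiLin (b : Fin n → ℤ) : Laurent n →ₗ[K] LaurentSeries ℂ :=
  (Finsupp.lsum K fun u : Fin n → ℤ =>
    LinearMap.toSpanSingleton K _ (HahnSeries.ofPowerSeries ℤ ℂ (D.G b u))) ∘ₗ
    (AddMonoidAlgebra.coeffLinearEquiv K).toLinearMap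

theorem xiLin_single (b u : Fin n → ℤ) (r : K) :
    D.xiLin b (AddMonoidAlgebra.single u r) =
      toLaurent r * HahnSeries.ofPowerSeries ℤ ℂ (D.G b u) := by
  simp [xiLin, Algebra.smul_def, toLaurent]

theorem toLaurent_intCast_eq (z : ℤ) :
    toLaurent (z : K) = HahnSeries.ofPowerSeries ℤ ℂ (PowerSeries.C (z : ℂ)) := by
  simp

theorem toLaurent_natCast_eq (z : ℕ) :
    toLaurent (z : K) = HahnSeries.ofPowerSeries ℤ ℂ (PowerSeries.C (z : ℂ)) := by
  simp

/-- Expanding `u` and `ℓ0 a0` in the `a_j` exhibits this as the sum of the relations `G_relation`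
weighted by the `i`-th entries of the `a_j`. -/
theorem G_Di_relation {b u : Fin n → ℤ} (hb : b ∈ D.B) (hu : u ∈ D.M) (i : Fin n) :
    PowerSeries.C ((u i : ℤ) : ℂ) * D.G b u +
      (∑ j, PowerSeries.C ((D.a j i : ℤ) : ℂ) * PowerSeries.C (D.ℓ j : ℂ) * D.G b (D.a j + u) -
        PowerSeries.C ((D.a0 i : ℤ) : ℂ) * (PowerSeries.C (D.ℓ0 : ℂ) * PowerSeries.X) *
          D.G b (D.a0 + u)) = 0 := by
  have e1 : PowerSeries.C ((u i : ℤ) : ℂ) =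
      ∑ j, PowerSeries.C (D.coord u j : ℂ) * PowerSeries.C ((D.a j i : ℤ) : ℂ) := by
    simp_rw [← map_mul, ← map_sum]
    congr 1
    have := hasCoords_coord hu i
    exact_mod_cast congrArg (fun x : ℝ => (x : ℂ)) this
  have e2 : PowerSeries.C ((D.a0 i : ℤ) : ℂ) * PowerSeries.C (D.ℓ0 : ℂ) =
      ∑ j, PowerSeries.C (D.ℓ j : ℂ) * PowerSeries.C ((D.a j i : ℤ) : ℂ) := by
    simp_rw [← map_mul, ← map_sum]
    congr 1
    have := congrFun D.relation i
    simp only [Pi.smul_apply, Finset.sum_apply, nsmul_eq_mul] at this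
    rw [mul_comm]
    exact_mod_cast congrArg (fun x : ℤ => (x : ℂ)) this
  rw [← mul_assoc (PowerSeries.C ((D.a0 i : ℤ) : ℂ)), e1, e2, Finset.sum_mul, Finset.sum_mul,
    Finset.sum_mul, ← Finset.sum_sub_distrib, ← Finset.sum_add_distrib]
  refine Finset.sum_eq_zero fun j _ => ?_
  linear_combination PowerSeries.C ((D.a j i : ℤ) : ℂ) * G_relation hb hu j

theorem factor_out_of_relation {R ι : Type*} [CommRing R] (s : Finset ι) (r c g c₀ g₀ : R)
    (d h : ι → R) : c * r * g + (∑ j ∈ s, d j * r * h j - c₀ * r * g₀) =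
      r * (c * g + (∑ j ∈ s, d j * h j - c₀ * g₀)) := by
  rw [mul_add, mul_sub, Finset.mul_sum, Finset.sum_congr rfl fun j _ => mul_right_comm (d j) r (h j)]
  simp only [mul_comm r]
  ring

theorem xiLin_Di {b : Fin n → ℤ} (hb : b ∈ D.B) {k : D.Coset} (i : Fin n) {p : Laurent n}
    (hp : p ∈ D.S k) : D.xiLin b (D.Di i p) = 0 := by
  refine D.S_induction (P := fun p => D.xiLin b (D.Di i p) = 0) ?_ ?_ ?_ hp
  · simp
  · intro p q hp hq
    rw [map_add, map_add, hp, hq, add_zero]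
  · intro u hu r
    have key := congrArg (HahnSeries.ofPowerSeries ℤ ℂ) (G_Di_relation hb hu.1 i)
    rw [map_zero] at key
    simp only [map_add, map_sub, map_mul, map_sum, HahnSeries.ofPowerSeries_X,
      ← toLaurent_intCast_eq, ← toLaurent_natCast_eq] at key
    rw [Di_single]
    simp only [map_add, map_sub, map_sum, xiLin_single, map_mul, toLaurent_X]
    rw [factor_out_of_relation, key, mul_zero]

variable (D) in
/-- The `ℂ(λ)`-linear map `ξ_b : 𝒲'_k → ℂ((λ))` with `ξ_b(x^u) = G_u^{(b)}`. -/
def xi {b : Fin n → ℤ} (hb : b ∈ D.B) (k : D.Coset) : D.W k →ₗ[K] LaurentSeries ℂ :=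
  (D.relations k).liftQ (D.xiLin b ∘ₗ (D.S k).subtype) (by
    intro p hp
    have h : (⨆ i, (D.S k).map (D.Di i)) ≤ LinearMap.ker (D.xiLin b) := by
      refine iSup_le fun i => ?_
      rintro _ ⟨q, hq, rfl⟩
      exact xiLin_Di hb i hq
    exact h hp)

theorem xi_mono {b : Fin n → ℤ} (hb : b ∈ D.B) {k : D.Coset} {u : Fin n → ℤ} (hu : u ∈ D.Mk k) :
    D.xi hb k (D.mono k u hu) = HahnSeries.ofPowerSeries ℤ ℂ (D.G b u) := by
  change D.xiLin b (AddMonoidAlgebra.single u 1) = _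
  rw [xiLin_single, map_one, one_mul]

theorem delL_ofPowerSeries (p : PowerSeries ℂ) :
    delL (HahnSeries.ofPowerSeries ℤ ℂ p) =
      HahnSeries.ofPowerSeries ℤ ℂ (PowerSeries.derivative ℂ p) := by
  ext N
  rw [delL_coeff, PowerSeries.coeff_coe, PowerSeries.coeff_coe]
  rcases lt_trichotomy N (-1) with h | rfl | h
  · rw [if_pos (by omega), if_pos (by omega), mul_zero]
  · simp
  · obtain ⟨k, rfl⟩ := Int.eq_ofNat_of_zero_le (by omega : 0 ≤ N)
    rw [if_neg (by omega), if_neg (by omega), ← Nat.cast_succ, Int.natAbs_natCast,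
      Int.natAbs_natCast, PowerSeries.coeff_derivative]
    push_cast
    ring

theorem xi_DlamW {b : Fin n → ℤ} (hb : b ∈ D.B) {k : D.Coset} (w : D.W k) :
    D.xi hb k (D.DlamW k w) = delL (D.xi hb k w) := by
  obtain ⟨⟨p, hp⟩, rfl⟩ := Submodule.Quotient.mk_surjective _ w
  rw [DlamW_mk]
  change D.xiLin b (D.Dlam p) = delL (D.xiLin b p)
  refine D.S_induction (P := fun p => D.xiLin b (D.Dlam p) = delL (D.xiLin b p)) ?_ ?_ ?_ hp
  · simp
  · intro p q hp hq
    simp only [map_add, hp, hq]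
  · intro u hu r
    rw [Dlam_single, map_sub, xiLin_single, xiLin_single, xiLin_single, delL_toLaurent_mul,
      delL_ofPowerSeries, delL_G hb hu.1]
    simp
    ring

theorem xi_lamW {b : Fin n → ℤ} (hb : b ∈ D.B) {k : D.Coset} (w : D.W k) :
    D.xi hb k (D.lamW k w) = lamL (D.xi hb k w) := by
  change D.xi hb k ((RatFunc.X : K) • w) = _
  rw [map_smul, Algebra.smul_def]
  change toLaurent RatFunc.X * _ = _
  rw [toLaurent_X]
  rfl

end Datum

/-! ### Spanning of `𝒲'_k` by the monomials of `𝓑_k` -/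

theorem one_sub_X_pow_ne_zero {p : ℕ} (hp : 0 < p) : (1 : K) - RatFunc.X ^ p ≠ 0 := by
  intro h
  have h1 : algebraMap (Polynomial ℂ) K 1 = algebraMap (Polynomial ℂ) K (Polynomial.X ^ p) := by
    rw [map_one, map_pow, RatFunc.algebraMap_X, sub_eq_zero.1 h]
  have h2 := congrArg Polynomial.natDegree (RatFunc.algebraMap_injective ℂ h1)
  rw [Polynomial.natDegree_one, Polynomial.natDegree_X_pow] at h2
  omega

/-- If multiplication by `c` modulo `U` moves the vectors `x i` around inside a finite set, then
they all lie in `U`, as soon as no power of `c` is `1`. -/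
theorem mem_of_sub_smul_mem {F V ι : Type*} [Field F] [AddCommGroup V] [Module F V] [Finite ι]
    (U : Submodule F V) (c : F) (hc : ∀ p : ℕ, 0 < p → 1 - c ^ p ≠ 0) (x : ι → V)
    (h : ∀ i, x i ∈ U ∨ ∃ i', x i - c • x i' ∈ U) (i : ι) : x i ∈ U := by
  by_contra hi
  let Bad := {i // x i ∉ U}
  -- The partner of a vector outside `U` is outside `U` too, so the partner map can be iterated.
  have step : ∀ i : Bad, ∃ i' : Bad, x i - c • x i' ∈ U := fun i => by
    obtain ⟨i', hi'⟩ := (h i).resolve_left i.2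
    exact ⟨⟨i', fun h' => i.2 (by simpa using add_mem hi' (U.smul_mem c h'))⟩, hi'⟩
  choose φ hφ using step
  have iter : ∀ (p : ℕ) (i : Bad), x i - c ^ p • x (φ^[p] i) ∈ U := fun p => by
    induction p with
    | zero => simp
    | succ p ih =>
      intro i
      have h1 := add_mem (hφ i) (U.smul_mem c (ih (φ i)))
      rw [smul_sub, smul_smul, ← pow_succ', sub_add_sub_cancel] at h1
      exact h1
  -- By finiteness the orbit runs into a cycle; a vector on a cycle of length `r + 1` satisfies `(1
  -- - c^(r+1)) x ∈ U`, a contradiction.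
  obtain ⟨p, q, hne, hpq⟩ := Finite.exists_ne_map_eq_of_infinite (fun p : ℕ => φ^[p] ⟨i, hi⟩)
  wlog hlt : p < q generalizing p q
  · exact this q p hne.symm hpq.symm (by omega)
  obtain ⟨r, rfl⟩ := Nat.exists_eq_add_of_lt hlt
  have e : φ^[r + 1] (φ^[p] ⟨i, hi⟩) = φ^[p] ⟨i, hi⟩ := by
    rw [← Function.iterate_add_apply, add_comm, ← add_assoc]
    exact hpq.symm
  have h1 := iter (r + 1) (φ^[p] ⟨i, hi⟩)
  rw [e] at h1
  nth_rewrite 1 [← one_smul F (x _)] at h1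
  rw [← sub_smul] at h1
  exact (φ^[p] ⟨i, hi⟩).2 ((U.smul_mem_iff (hc _ r.succ_pos)).1 h1)

namespace Datum

variable {n m : ℕ} {D : Datum n m}

variable (D) in
-- A left inverse of `c ↦ ∑ c_j a_j` exists by independence. Its components are the weights that
-- turn the relations `D_i` into relations for one coordinate at a time.
theorem exists_dual (j : Fin m) : ∃ w : Fin n → ℝ, ∀ (u : Fin n → ℤ) (c : Fin m → ℝ),
    D.HasCoords u c → ∑ i, w i * u i = c j := by
  obtain ⟨g, hg⟩ := LinearMap.exists_leftInverse_of_injective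
    (Fintype.linearCombination ℝ (fun j => fun i => (D.a j i : ℝ)))
    (LinearMap.ker_eq_bot.2 D.linearIndependent.fintypeLinearCombination_injective)
  refine ⟨fun i => g (fun i' => if i = i' then 1 else 0) j, fun u c h => ?_⟩
  have h1 : Fintype.linearCombination ℝ (fun j => fun i => (D.a j i : ℝ)) c =
      fun i => (u i : ℝ) := by
    ext i
    simp [Fintype.linearCombination_apply, h i]
  have h2 := congrFun (LinearMap.congr_fun hg c) j
  rw [LinearMap.comp_apply, h1, LinearMap.id_apply, LinearMap.pi_apply_eq_sum_univ] at h2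
  rw [← h2]
  simp [Finset.sum_apply, mul_comm]

theorem Di_single_eq_zero {k : D.Coset} {u : Fin n → ℤ} (hu : u ∈ D.Mk k) (i : Fin n) :
    (u i : K) • D.mono k u hu +
      (∑ j, ((D.a j i : K) * D.ℓ j) • D.mono k (D.a j + u) (D.a_add_mem_Mk j hu) -
        ((D.a0 i : K) * ((D.ℓ0 : K) * RatFunc.X)) • D.mono k (D.a0 + u) (D.a0_add_mem_Mk hu)) = 0 := by
  have h : (⟨D.Di i (AddMonoidAlgebra.single u 1), D.Di_mem_S i (D.single_mem_S hu 1)⟩ : D.S k) ∈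
      D.relations k :=
    Submodule.mem_iSup_of_mem (p := fun i => (D.S k).map (D.Di i)) i
      ⟨_, D.single_mem_S hu 1, rfl⟩
  rw [← (Submodule.Quotient.mk_eq_zero (D.relations k)).2 h]
  simp only [mono, ← Submodule.mkQ_apply, ← map_smul, ← map_sum, ← map_sub, ← map_add]
  congr 1
  apply Subtype.ext
  refine Eq.trans ?_ (D.Di_single i u 1).symm
  simp

/-- Weighting the relations `D_i x^u = 0` by the functional dual to `a_j` leaves only `a_j` in the
sum, and `a0` contributes `ℓ0 · (ℓ_j / ℓ0) = ℓ_j`. -/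
theorem mono_relation {k : D.Coset} {u : Fin n → ℤ} (hu : u ∈ D.Mk k) (j : Fin m) :
    algebraMap ℂ K (D.coord u j) • D.mono k u hu +
      (D.ℓ j : K) • D.mono k (D.a j + u) (D.a_add_mem_Mk j hu) =
      ((D.ℓ j : K) * RatFunc.X) • D.mono k (D.a0 + u) (D.a0_add_mem_Mk hu) := by
  obtain ⟨w, hw⟩ := D.exists_dual j
  have hw' : ∀ (v : Fin n → ℤ) (c : Fin m → ℝ), D.HasCoords v c →
      ∑ i, algebraMap ℂ K (w i) * (v i : K) = algebraMap ℂ K (c j : ℂ) := fun v c h => by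
    have := congrArg (fun x : ℝ => algebraMap ℂ K (x : ℂ)) (hw v c h)
    rw [← this]
    simp
  have h := Finset.sum_congr rfl fun i (_ : i ∈ Finset.univ) =>
    congrArg (algebraMap ℂ K (w i) • ·) (Di_single_eq_zero hu i)
  simp only [smul_zero, Finset.sum_const_zero, smul_add, smul_sub, Finset.smul_sum,
    Finset.sum_add_distrib, Finset.sum_sub_distrib, smul_smul, ← mul_assoc] at h
  rw [Finset.sum_comm] at h
  simp only [← Finset.sum_smul, ← Finset.sum_mul] at h
  rw [hw' u _ (hasCoords_coord hu.1), hw' _ _ D.HasCoords_a0] at h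
  simp only [hw' _ _ (D.HasCoords_a _)] at h
  rw [Finset.sum_eq_single j (fun i _ hi => by simp [hi.symm]) (by simp)] at h
  have h0 : (D.ℓ0 : K) ≠ 0 := by exact_mod_cast D.ℓ0_pos.ne'
  have e : algebraMap ℂ K (((D.ℓ j / D.ℓ0 : ℝ)) : ℂ) * D.ℓ0 = D.ℓ j := by
    push_cast
    simp [h0]
  rw [e, ← add_sub_assoc, sub_eq_zero] at h
  simpa using h

/-- Nonnegative coordinates of fixed sum are bounded, hence so are the lattice points. The
finiteness feeds the cycle argument of `mem_of_sub_smul_mem`. -/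
theorem finite_setOf_sum_coord_eq (d : ℝ) :
    {u : Fin n → ℤ | u ∈ D.M ∧ ∑ j, D.coord u j = d}.Finite := by
  let N : Fin n → ℤ := fun i => ⌈∑ j, |d| * |(D.a j i : ℝ)|⌉
  refine (Set.finite_Icc (-N) N).subset ?_
  rintro u ⟨hu, hd⟩
  have h : ∀ i, |u i| ≤ N i := fun i => by
    have h1 : |(u i : ℝ)| ≤ ∑ j, |d| * |(D.a j i : ℝ)| := by
      rw [hasCoords_coord hu i]
      refine (Finset.abs_sum_le_sum_abs _ _).trans (Finset.sum_le_sum fun j _ => ?_)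
      rw [abs_mul, abs_of_nonneg (coord_nonneg hu j)]
      refine mul_le_mul_of_nonneg_right (le_trans ?_ (le_abs_self d)) (abs_nonneg _)
      rw [← hd]
      exact Finset.single_le_sum (fun j _ => coord_nonneg hu j) (Finset.mem_univ j)
    have h2 := h1.trans (Int.le_ceil _)
    simp only [N]
    exact_mod_cast h2
  exact ⟨fun i => (abs_le.1 (h i)).1, fun i => (abs_le.1 (h i)).2⟩

variable (D) in
theorem sum_coord_a0 : ∑ j, (D.ℓ j : ℝ) / D.ℓ0 = 1 := by
  have h0 : (D.ℓ0 : ℝ) ≠ 0 := by exact_mod_cast D.ℓ0_pos.ne'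
  rw [← Finset.sum_div, div_eq_one_iff_eq h0, D.ℓ0_eq_sum]
  push_cast
  rfl

theorem exists_sub_a_mem_Mk {k : D.Coset} {u : Fin n → ℤ} (hu : u ∈ D.Mk k) (hB : u ∉ D.B) :
    ∃ j, ∃ v, ∃ _ : v ∈ D.Mk k, u = D.a j + v := by
  have h : ∃ j, 1 ≤ D.coord u j := by
    by_contra! h
    exact hB ⟨_, hasCoords_coord hu.1, fun j => ⟨coord_nonneg hu.1 j, h j⟩⟩
  obtain ⟨j, hj⟩ := h
  refine ⟨j, u - D.a j, ⟨⟨_, (hasCoords_coord hu.1).sub (D.HasCoords_a j), fun i => ?_⟩, ?_⟩,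
    by abel⟩
  · simp only [Pi.sub_apply]
    split_ifs with hi
    · subst hi; linarith
    · simpa using coord_nonneg hu.1 i
  · rw [← hu.2, QuotientAddGroup.eq]
    have : -(u - D.a j) + u = D.a j := by abel
    rw [this]
    exact AddSubgroup.subset_closure (Set.mem_insert_of_mem _ ⟨j, rfl⟩)

/-- `𝒲'_k` is spanned by the `x^b`, `b ∈ 𝓑_k`. -/
theorem mono_mem_span {k : D.Coset} {u : Fin n → ℤ} (hu : u ∈ D.Mk k) : D.mono k u hu ∈
    Submodule.span K (Set.range fun b : D.Bk k => D.mono k b (D.Bk_subset_Mk k b.2)) := by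
  set U := Submodule.span K (Set.range fun b : D.Bk k => D.mono k b (D.Bk_subset_Mk k b.2)) with hU
  obtain ⟨N, hN⟩ := exists_nat_gt (∑ j, D.coord u j)
  induction N generalizing u with
  | zero =>
    exact absurd hN (not_lt.2 (by simpa using Finset.sum_nonneg fun j _ => coord_nonneg hu.1 j))
  | succ N ih =>
    -- The degree is the coordinate sum, and both `a_j` and `a0` have degree `1`. Modulo lower
    -- degree, `x^(a_j + v')` equals `λ x^(a0 + v')` of the same degree, so monomials outside `𝓑`
    -- are permuted up to the factor `λ` within a finite set or reach `𝓑`.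
    let ι := {v : Fin n → ℤ // v ∈ D.Mk k ∧ ∑ j, D.coord v j = ∑ j, D.coord u j}
    have : Finite ι := ((D.finite_setOf_sum_coord_eq (∑ j, D.coord u j)).subset
      fun v hv => ⟨hv.1.1, hv.2⟩).to_subtype
    refine mem_of_sub_smul_mem (ι := ι) U RatFunc.X (fun p => one_sub_X_pow_ne_zero)
      (fun v => D.mono k v v.2.1) ?_ ⟨u, hu, rfl⟩
    rintro ⟨v, hv, hd⟩
    by_cases hB : v ∈ D.B
    · exact Or.inl (Submodule.subset_span ⟨⟨v, hB, hv.2⟩, rfl⟩)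
    obtain ⟨j, v', hv', rfl⟩ := exists_sub_a_mem_Mk hv hB
    have d1 : ∑ i, D.coord (D.a j + v') i = 1 + ∑ i, D.coord v' i := by
      rw [((D.HasCoords_a j).add (hasCoords_coord hv'.1)).coord_eq]
      simp [Finset.sum_add_distrib]
    have d2 : ∑ i, D.coord (D.a0 + v') i = 1 + ∑ i, D.coord v' i := by
      rw [(D.HasCoords_a0.add (hasCoords_coord hv'.1)).coord_eq]
      simp [Finset.sum_add_distrib, D.sum_coord_a0]
    have h1 := ih hv' (by rw [← hd, d1] at hN; push_cast at hN; linarith)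
    refine Or.inr ⟨⟨D.a0 + v', D.a0_add_mem_Mk hv', by rw [d2, ← d1, hd]⟩, ?_⟩
    have h0 : (D.ℓ j : K) ≠ 0 := by exact_mod_cast (D.ℓ_pos j).ne'
    rw [← U.smul_mem_iff h0, smul_sub, smul_smul, ← mono_relation hv' j, sub_add_cancel_right]
    exact neg_mem (U.smul_mem _ h1)

theorem span_mono_eq_top (k : D.Coset) :
    Submodule.span K (Set.range fun b : D.Bk k => D.mono k b (D.Bk_subset_Mk k b.2)) = ⊤ := by
  refine eq_top_iff.2 fun w _ => ?_
  obtain ⟨⟨p, hp⟩, rfl⟩ := Submodule.Quotient.mk_surjective _ w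
  -- The membership proof is made part of the predicate because `S_induction` speaks of bare Laurent
  -- polynomials.
  suffices h : ∃ hp' : p ∈ D.S k, (Submodule.Quotient.mk ⟨p, hp'⟩ : D.W k) ∈ Submodule.span K
    (Set.range fun b : D.Bk k => D.mono k b (D.Bk_subset_Mk k b.2)) from h.choose_spec
  refine D.S_induction (P := fun p => ∃ hp' : p ∈ D.S k,
    (Submodule.Quotient.mk ⟨p, hp'⟩ : D.W k) ∈ _) ?_ ?_ ?_ hp
  · exact ⟨zero_mem _, zero_mem _⟩
  · rintro p q ⟨hp, hp'⟩ ⟨hq, hq'⟩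
    exact ⟨add_mem hp hq, add_mem hp' hq'⟩
  · intro u hu r
    refine ⟨D.single_mem_S hu r, ?_⟩
    convert Submodule.smul_mem _ r (mono_mem_span hu) using 1
    rw [mono, ← Submodule.Quotient.mk_smul]
    congr 1
    apply Subtype.ext
    simp

theorem finite_Bk (k : D.Coset) : (D.Bk k).Finite := by
  rcases (D.Bk k).eq_empty_or_nonempty with h | ⟨b, hb⟩
  · rw [h]; exact Set.finite_empty
  · refine ((Finset.range D.ℓ0).finite_toSet.image fun s => D.frac (b + s • D.a0)).subset ?_
    intro b' hb'
    obtain ⟨s, hs, rfl⟩ := exists_frac_add_a0_eq (D.Bk_subset_Mk k hb) hb'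
    exact ⟨s, by simpa using hs, rfl⟩

/-! ### Separation of points by the solutions -/

open Classical in
-- At `λ = 0` the matrix is the identity: `b` is its own reduction and `gam b` is an empty product.
-- So the determinant has constant term `1`.
theorem det_G_ne_zero (k : D.Coset) [Fintype (D.Bk k)] :
    (Matrix.of fun b b' : D.Bk k =>
      HahnSeries.ofPowerSeries ℤ ℂ (D.G b'.1 b.1)).det ≠ 0 := by
  set Φ : Matrix (D.Bk k) (D.Bk k) (PowerSeries ℂ) := Matrix.of fun b b' => D.G b'.1 b.1 with hΦ
  have h1 : PowerSeries.constantCoeff Φ.det = 1 := by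
    have e : PowerSeries.constantCoeff.mapMatrix Φ = 1 := ?_
    · rw [RingHom.map_det, e, Matrix.det_one]
    ext b b'
    have hM := D.B_subset_M b.2.1
    rw [RingHom.mapMatrix_apply, Matrix.map_apply, hΦ, Matrix.of_apply,
      ← PowerSeries.coeff_zero_eq_constantCoeff_apply, coeff_G b'.2.1 hM, zero_smul, add_zero,
      frac_eq_self b.2.1, Matrix.one_apply]
    have h2 : D.gam b.1 = 1 := by simp [gam, floorVec_eq_zero b.2.1, bracketNeg]
    simp [h2, Subtype.ext_iff, eq_comm]
  have h3 : (Matrix.of fun b b' : D.Bk k => HahnSeries.ofPowerSeries ℤ ℂ (D.G b'.1 b.1)) =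
      (HahnSeries.ofPowerSeries ℤ ℂ).mapMatrix Φ := rfl
  rw [h3, ← RingHom.map_det]
  intro h
  rw [map_eq_zero_iff _ HahnSeries.ofPowerSeries_injective] at h
  rw [h, map_zero] at h1
  exact zero_ne_one h1

/-- The solutions `ξ_b`, `b ∈ 𝓑_k`, jointly separate the points of `𝒲'_k`. -/
theorem eq_zero_of_xi_eq_zero {k : D.Coset} {w : D.W k}
    (h : ∀ b, ∀ hb : b ∈ D.Bk k, D.xi hb.1 k w = 0) : w = 0 := by
  classical
  have := (D.finite_Bk k).fintype
  have hw : w ∈ Submodule.span K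
      (Set.range fun b : D.Bk k => D.mono k b (D.Bk_subset_Mk k b.2)) := by
    rw [span_mono_eq_top]; trivial
  obtain ⟨c, rfl⟩ := (Submodule.mem_span_range_iff_exists_fun K).1 hw
  -- Vanishing of all `ξ_{b'}` on `∑ c_b x^b` says that the row vector `c` is annihilated by the
  -- solution matrix.
  have h1 : (fun b => toLaurent (c b)) = 0 := by
    refine Matrix.eq_zero_of_vecMul_eq_zero (D.det_G_ne_zero k) ?_
    ext1 b'
    rw [Matrix.vecMul, dotProduct, Pi.zero_apply, ← h b'.1 b'.2, map_sum]
    refine Finset.sum_congr rfl fun b _ => ?_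
    rw [map_smul, xi_mono, Algebra.smul_def]
    rfl
  refine Finset.sum_eq_zero fun b _ => ?_
  have h2 : c b = 0 := by simpa using congrFun h1 b
  rw [h2, zero_smul]

end Datum

/-! ### Hypergeometric operators on `ℂ((λ))` -/

theorem lamL_pow_coeff (e : ℕ) (y : LaurentSeries ℂ) (N : ℤ) :
    ((lamL ^ e) y).coeff N = y.coeff (N - e) := by
  induction e generalizing N with
  | zero => simp
  | succ e ih =>
    rw [pow_succ', Module.End.mul_apply, lamL_coeff, ih]
    congr 1
    push_cast
    ring

/-- `λ^N` is an eigenvector of `c λ d/dλ` with eigenvalue `c N`. This turns the hypergeometric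
equation into a two-term recursion with step `e`. -/
theorem aeval_euler_coeff (c : ℂ) (p : Polynomial ℂ) (y : LaurentSeries ℂ) (N : ℤ) :
    (Polynomial.aeval (c • (lamL * delL) : Module.End ℂ (LaurentSeries ℂ)) p y).coeff N =
      p.eval (c * N) * y.coeff N := by
  have h1 : ∀ z : LaurentSeries ℂ,
      ((c • (lamL * delL) : Module.End ℂ (LaurentSeries ℂ)) z).coeff N = c * N * z.coeff N := by
    intro z
    rw [LinearMap.smul_apply, HahnSeries.coeff_smul, Module.End.mul_apply, lamL_coeff, delL_coeff,
      sub_add_cancel, smul_eq_mul]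
    push_cast
    ring
  induction p using Polynomial.induction_on with
  | C a => simp [Module.algebraMap_end_apply]
  | add p q hp hq => simp [hp, hq, add_mul]
  | monomial k a h =>
    rw [pow_succ', mul_left_comm, map_mul (Polynomial.aeval _), Module.End.mul_apply,
      Polynomial.aeval_X, h1, h, Polynomial.eval_mul (p := Polynomial.X), Polynomial.eval_X]
    ring

theorem hypergeometricOpPow_coeff (e : ℕ) (α β : Multiset ℝ) (y : LaurentSeries ℂ) (N : ℤ) :
    (hypergeometricOpPow (E := Module.End ℂ (LaurentSeries ℂ)) e lamL delL α β y).coeff N =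
      (β.map fun t : ℝ => (e : ℂ)⁻¹ * N + ((t : ℂ) - 1)).prod * y.coeff N -
      (α.map fun t : ℝ => (e : ℂ)⁻¹ * ((N - e : ℤ) : ℂ) + (t : ℂ)).prod * y.coeff (N - e) := by
  rw [hypergeometricOpPow, hypergeometricOp, LinearMap.sub_apply, HahnSeries.coeff_sub,
    aeval_euler_coeff, Module.End.mul_apply, lamL_pow_coeff, aeval_euler_coeff]
  simp [Polynomial.eval_multiset_prod, Multiset.map_map]

theorem map_aeval_of_semiconj {V V' : Type*} [AddCommGroup V] [Module ℂ V] [AddCommGroup V']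
    [Module ℂ V'] (φ : V →ₗ[ℂ] V') {A : Module.End ℂ V} {A' : Module.End ℂ V'}
    (h : ∀ v, φ (A v) = A' (φ v)) (p : Polynomial ℂ) (v : V) :
    φ (Polynomial.aeval A p v) = Polynomial.aeval A' p (φ v) := by
  induction p using Polynomial.induction_on generalizing v with
  | C a => simp [Module.algebraMap_end_apply]
  | add p q hp hq => simp [hp, hq]
  | monomial k a ih =>
    rw [pow_succ, ← mul_assoc, map_mul (Polynomial.aeval A), map_mul (Polynomial.aeval A'),
      Module.End.mul_apply, Module.End.mul_apply, Polynomial.aeval_X, Polynomial.aeval_X, ih, h]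

theorem map_hypergeometricOpPow {V V' : Type*} [AddCommGroup V] [Module ℂ V] [AddCommGroup V']
    [Module ℂ V'] (φ : V →ₗ[ℂ] V') {l d : Module.End ℂ V} {l' d' : Module.End ℂ V'}
    (hl : ∀ v, φ (l v) = l' (φ v)) (hd : ∀ v, φ (d v) = d' (φ v)) (e : ℕ) (α β : Multiset ℝ)
    (v : V) : φ (hypergeometricOpPow e l d α β v) = hypergeometricOpPow e l' d' α β (φ v) := by
  have h : ∀ v, φ (((e : ℂ)⁻¹ • (l * d)) v) = ((e : ℂ)⁻¹ • (l' * d')) (φ v) := fun v => by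
    simp [hl, hd]
  have h' : ∀ v, φ ((l ^ e) v) = (l' ^ e) (φ v) := fun v => by
    have := map_aeval_of_semiconj φ hl (Polynomial.X ^ e) v
    simpa using this
  simp only [hypergeometricOpPow, hypergeometricOp, LinearMap.sub_apply, map_sub,
    Module.End.mul_apply, map_aeval_of_semiconj φ h, h']

namespace Datum

variable {n m : ℕ} {D : Datum n m}

/-! ### The hypergeometric recursion -/

variable (D) in
/-- The list of all `(v_j + σ) / ℓ_j`, before cancellation. -/
def fullAlpha (b : Fin n → ℤ) : Multiset ℝ :=
  ∑ j, (Multiset.range (D.ℓ j)).map fun σ : ℕ => (D.coord b j + (σ : ℝ)) / D.ℓ j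

variable (D) in
/-- The cancelled elements. -/
def cancelledElements (b : Fin n → ℤ) : Multiset ℝ :=
  (D.cancelled b).val.map fun s : ℕ => 1 - (s : ℝ) / D.ℓ0

theorem injective_one_sub_div : Function.Injective fun s : ℕ => 1 - (s : ℝ) / D.ℓ0 := by
  intro s t h
  have h0 : (D.ℓ0 : ℝ) ≠ 0 := by exact_mod_cast D.ℓ0_pos.ne'
  simp only [sub_right_inj] at h
  rw [div_left_inj' h0] at h
  exact_mod_cast h

/-- A cancelled `s` has `v_j + s ℓ_j / ℓ0 = t` with an integer `t > 0` for some `j`, so `1 - s/ℓ0 =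
(v_j + σ)/ℓ_j` with `σ = ℓ_j - t`. The cancelled elements are distinct, so membership suffices, and
the multiset subtraction in `alpha` truncates nothing. -/
theorem cancelledElements_le {b : Fin n → ℤ} (hb : b ∈ D.B) :
    D.cancelledElements b ≤ D.fullAlpha b := by
  rw [cancelledElements, Multiset.le_iff_subset ((D.cancelled b).nodup.map injective_one_sub_div)]
  intro x hx
  obtain ⟨s, hs, rfl⟩ := Multiset.mem_map.1 hx
  have hs' := (mem_cancelled_iff hb s).1 (Finset.mem_def.2 hs)
  have hbM := D.B_subset_M hb
  have hM := add_nsmul_a0_mem_M hbM s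
  have h1 := (gam_add_a0_eq_zero_iff hb hs'.1).2 (Finset.mem_def.2 hs)
  obtain ⟨j, hj, ht⟩ := (gam_eq_zero_iff hM).1 h1
  rw [coord_frac hM, coord_add_a0 hbM, sub_eq_zero] at hj
  set t := D.floorVec (b + s • D.a0) j
  have h0 : (0 : ℝ) < D.ℓ0 := by exact_mod_cast D.ℓ0_pos
  have hl : (0 : ℝ) < D.ℓ j := by exact_mod_cast D.ℓ_pos j
  -- `v_j < 1` and `s ≤ ℓ0` give `t < ℓ_j + 1`.
  have ht' : t ≤ D.ℓ j := by
    have h2 : (s : ℝ) * (D.ℓ j / D.ℓ0) ≤ D.ℓ j := by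
      have : (s : ℝ) ≤ D.ℓ0 := by exact_mod_cast hs'.1.le
      calc (s : ℝ) * (D.ℓ j / D.ℓ0) ≤ D.ℓ0 * (D.ℓ j / D.ℓ0) := by gcongr
        _ = D.ℓ j := by field_simp
    have h3 := coord_lt_one hb j
    have h4 : (t : ℝ) < (D.ℓ j + 1 : ℕ) := by push_cast; linarith
    exact Nat.lt_succ_iff.1 (by exact_mod_cast h4)
  rw [fullAlpha, Multiset.mem_sum]
  refine ⟨j, Finset.mem_univ _, Multiset.mem_map.2 ⟨D.ℓ j - t, Multiset.mem_range.2 (by omega), ?_⟩⟩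
  rw [Nat.cast_sub ht', ← hj]
  field_simp
  ring

theorem alpha_add_cancelledElements {b : Fin n → ℤ} (hb : b ∈ D.B) :
    D.alpha b + D.cancelledElements b = D.fullAlpha b := by
  rw [← tsub_add_cancel_of_le (cancelledElements_le hb)]
  simp only [alpha, fullAlpha, cancelledElements, bind_pure_comp, Multiset.fmap_def,
    Multiset.map_map, Function.comp_def]

open Classical in
theorem beta_eq (b : Fin n → ℤ) : D.beta b =
    (Finset.range D.ℓ0 \ D.cancelled b).val.map fun s : ℕ => 1 - (s : ℝ) / D.ℓ0 := by
  simp only [beta, bind_pure_comp, Multiset.fmap_def, Multiset.map_map, Function.comp_def]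

open Classical in
theorem cancelled_subset (b : Fin n → ℤ) : D.cancelled b ⊆ Finset.range D.ℓ0 :=
  Finset.filter_subset _ _

theorem card_beta (b : Fin n → ℤ) : (D.beta b).card = (Finset.range D.ℓ0 \ D.cancelled b).card := by
  rw [beta_eq, Multiset.card_map, Finset.card_val]

theorem card_alpha {b : Fin n → ℤ} (hb : b ∈ D.B) :
    (D.alpha b).card = (Finset.range D.ℓ0 \ D.cancelled b).card := by
  have h := congrArg Multiset.card (alpha_add_cancelledElements hb)
  have h2 : (D.fullAlpha b).card = D.ℓ0 := by
    rw [fullAlpha, Multiset.card_sum, D.ℓ0_eq_sum]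
    simp
  rw [Multiset.card_add, h2, cancelledElements, Multiset.card_map, Finset.card_val] at h
  rw [Finset.card_sdiff_of_subset (cancelled_subset b), Finset.card_range]
  omega

theorem prod_beta (b : Fin n → ℤ) (z : ℂ) :
    ((D.beta b).map fun t : ℝ => z + ((t : ℂ) - 1)).prod =
      ∏ s ∈ Finset.range D.ℓ0 \ D.cancelled b, (z - s / D.ℓ0) := by
  rw [beta_eq, Multiset.map_map, Finset.prod]
  congr 2
  ext s
  simp only [Function.comp_apply]
  push_cast
  ring

theorem prod_alpha {b : Fin n → ℤ} (hb : b ∈ D.B) (z : ℂ) :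
    ((D.alpha b).map fun t : ℝ => z + (t : ℂ)).prod * ∏ s ∈ D.cancelled b, (z + 1 - s / D.ℓ0) =
      ∏ j, ∏ σ ∈ Finset.range (D.ℓ j), (z + (D.coord b j + σ) / D.ℓ j) := by
  have h := congrArg (fun A : Multiset ℝ => (A.map fun t : ℝ => z + (t : ℂ)).prod)
    (alpha_add_cancelledElements hb)
  simp only [Multiset.map_add, Multiset.prod_add] at h
  convert h using 1
  · congr 1
    rw [cancelledElements, Multiset.map_map, Finset.prod]
    congr 2
    ext s
    simp only [Function.comp_apply]
    push_cast
    ring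
  · rw [fullAlpha, ← Multiset.coe_mapAddMonoidHom, map_sum, Multiset.prod_sum]
    refine Finset.prod_congr rfl fun j _ => ?_
    rw [Multiset.coe_mapAddMonoidHom, Multiset.map_map, Finset.prod]
    simp

variable (D) in
/-- The coefficient of `λ^N` in the sum of the entries of row `b`. -/
def rowCoeff (b : Fin n → ℤ) (N : ℕ) : ℂ :=
  D.gam (b + N • D.a0) * (-(D.ℓ0 : ℂ)) ^ N / N.factorial

theorem rowCoeff_eq_zero_iff {b : Fin n → ℤ} (hb : b ∈ D.B) {s : ℕ} (hs : s < D.ℓ0) :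
    D.rowCoeff b s = 0 ↔ s ∈ D.cancelled b := by
  have h0 : (D.ℓ0 : ℂ) ≠ 0 := by exact_mod_cast D.ℓ0_pos.ne'
  have h1 : (s.factorial : ℂ) ≠ 0 := by exact_mod_cast s.factorial_ne_zero
  rw [rowCoeff, ← gam_add_a0_eq_zero_iff hb hs, div_eq_zero_iff, or_iff_left h1, mul_eq_zero,
    or_iff_left (pow_ne_zero _ (neg_ne_zero.2 h0))]

variable (D) in
theorem prod_range_sub_div (N : ℕ) :
    (∏ s ∈ Finset.range D.ℓ0, ((D.ℓ0 : ℂ)⁻¹ * (N + D.ℓ0) - s / D.ℓ0)) * N.factorial *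
      (D.ℓ0 : ℂ) ^ D.ℓ0 = (N + D.ℓ0).factorial := by
  have h0 : (D.ℓ0 : ℂ) ≠ 0 := by exact_mod_cast D.ℓ0_pos.ne'
  have h1 : ∏ s ∈ Finset.range D.ℓ0, ((D.ℓ0 : ℂ)⁻¹ * (N + D.ℓ0) - s / D.ℓ0) * D.ℓ0 =
      ((N + D.ℓ0).descFactorial D.ℓ0 : ℕ) := by
    rw [Nat.descFactorial_eq_prod_range, Nat.cast_prod]
    refine Finset.prod_congr rfl fun s hs => ?_
    rw [Nat.cast_sub (by have := Finset.mem_range.1 hs; omega)]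
    push_cast
    field_simp
  rw [Finset.prod_mul_distrib, Finset.prod_const, Finset.card_range] at h1
  rw [mul_right_comm, h1, mul_comm, ← Nat.factorial_mul_descFactorial (Nat.le_add_left D.ℓ0 N),
    Nat.add_sub_cancel, Nat.cast_mul]

/-- `(N + ℓ0) a0` exceeds `N a0` by `∑ ℓ_j a_j`, so `gam` acquires the product over the full list of
`(v_j + σ)/ℓ_j`, while `(N + ℓ0)!/N!` is the product over all `s < ℓ0`. The factors of the cancelled
`s` are common to both. -/
theorem rowCoeff_add {b : Fin n → ℤ} (hb : b ∈ D.B) (N : ℕ) :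
    ((D.beta b).map fun t : ℝ => (D.ℓ0 : ℂ)⁻¹ * (N + D.ℓ0) + ((t : ℂ) - 1)).prod *
      D.rowCoeff b (N + D.ℓ0) =
    ((D.alpha b).map fun t : ℝ => (D.ℓ0 : ℂ)⁻¹ * N + (t : ℂ)).prod * D.rowCoeff b N := by
  have h0 : (D.ℓ0 : ℂ) ≠ 0 := by exact_mod_cast D.ℓ0_pos.ne'
  have hbM := D.B_subset_M hb
  have hgam : D.gam (b + (N + D.ℓ0) • D.a0) = D.gam (b + N • D.a0) * ((-1) ^ D.ℓ0 *
      ∏ j, ∏ σ ∈ Finset.range (D.ℓ j), ((D.ℓ0 : ℂ)⁻¹ * N + (D.coord b j + σ) / D.ℓ j)) := by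
    rw [add_smul, ← add_assoc, D.relation, gam_add_sum (add_nsmul_a0_mem_M hbM N)]
    congr 1
    have : ((-1 : ℂ)) ^ D.ℓ0 = ∏ j, ∏ σ ∈ Finset.range (D.ℓ j), (-1) := by
      simp [D.ℓ0_eq_sum, Finset.prod_pow_eq_pow_sum]
    rw [this, ← Finset.prod_mul_distrib]
    refine Finset.prod_congr rfl fun j _ => ?_
    rw [← Finset.prod_mul_distrib]
    refine Finset.prod_congr rfl fun σ _ => ?_
    have hl : (D.ℓ j : ℂ) ≠ 0 := by exact_mod_cast (D.ℓ_pos j).ne'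
    rw [coord_add_a0 hbM]
    push_cast
    field_simp
    ring
  rw [← prod_alpha hb] at hgam
  have hT : ∏ s ∈ D.cancelled b, ((D.ℓ0 : ℂ)⁻¹ * N + 1 - s / D.ℓ0) ≠ 0 := by
    refine Finset.prod_ne_zero_iff.2 fun s hs h => ?_
    have hs' := Finset.mem_range.1 (cancelled_subset b hs)
    field_simp at h
    have : N + D.ℓ0 = s := by
      rw [mul_zero, sub_eq_zero] at h
      exact_mod_cast h
    omega
  have hfull := Finset.prod_sdiff (f := fun s : ℕ => (D.ℓ0 : ℂ)⁻¹ * (N + D.ℓ0) - s / D.ℓ0)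
    (cancelled_subset (D := D) b)
  have hT' : ∏ s ∈ D.cancelled b, ((D.ℓ0 : ℂ)⁻¹ * (N + D.ℓ0) - s / D.ℓ0) =
      ∏ s ∈ D.cancelled b, ((D.ℓ0 : ℂ)⁻¹ * N + 1 - s / D.ℓ0) :=
    Finset.prod_congr rfl fun s _ => by field_simp
  have hfac := D.prod_range_sub_div N
  rw [prod_beta, rowCoeff, rowCoeff, hgam]
  rw [hT'] at hfull
  rw [← hfull] at hfac
  have hN : (N.factorial : ℂ) ≠ 0 := by exact_mod_cast N.factorial_ne_zero
  have hN' : ((N + D.ℓ0).factorial : ℂ) ≠ 0 := by exact_mod_cast (N + D.ℓ0).factorial_ne_zero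
  have hsign : (-(D.ℓ0 : ℂ)) ^ (N + D.ℓ0) * (-1) ^ D.ℓ0 = (-(D.ℓ0 : ℂ)) ^ N * D.ℓ0 ^ D.ℓ0 := by
    rw [pow_add, mul_assoc, ← mul_pow]; simp
  generalize ∏ s ∈ D.cancelled b, ((D.ℓ0 : ℂ)⁻¹ * N + 1 - s / D.ℓ0) = T at *
  generalize ∏ s ∈ Finset.range D.ℓ0 \ D.cancelled b, ((D.ℓ0 : ℂ)⁻¹ * (N + D.ℓ0) - s / D.ℓ0) = P at *
  generalize ((D.alpha b).map fun t : ℝ => (D.ℓ0 : ℂ)⁻¹ * N + (t : ℂ)).prod = Q at *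
  rw [mul_div_assoc', mul_div_assoc', div_eq_div_iff hN' hN, ← hfac]
  linear_combination P * Q * T * D.gam (b + N • D.a0) * N.factorial * hsign

/-! ### The solutions of the hypergeometric equation -/

/-- The hypergeometric operator of row `b`, acting on `ℂ((λ))`. -/
abbrev rowOp (D : Datum n m) (b : Fin n → ℤ) : Module.End ℂ (LaurentSeries ℂ) :=
  hypergeometricOpPow (E := Module.End ℂ (LaurentSeries ℂ)) D.ℓ0 lamL delL (D.alpha b) (D.beta b)

theorem prod_beta_eq_zero_iff (b : Fin n → ℤ) (N : ℤ) :
    ((D.beta b).map fun t : ℝ => (D.ℓ0 : ℂ)⁻¹ * N + ((t : ℂ) - 1)).prod = 0 ↔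
      ∃ s ∈ Finset.range D.ℓ0 \ D.cancelled b, N = (s : ℤ) := by
  have h0 : (D.ℓ0 : ℂ) ≠ 0 := by exact_mod_cast D.ℓ0_pos.ne'
  rw [prod_beta, Finset.prod_eq_zero_iff]
  refine exists_congr fun s => and_congr_right fun _ => ?_
  rw [inv_mul_eq_div, ← sub_div, div_eq_zero_iff, or_iff_left h0, sub_eq_zero]
  norm_cast

theorem rowOp_eq_zero_iff (b : Fin n → ℤ) (y : LaurentSeries ℂ) :
    D.rowOp b y = 0 ↔ ∀ N : ℤ,
      ((D.beta b).map fun t : ℝ => (D.ℓ0 : ℂ)⁻¹ * N + ((t : ℂ) - 1)).prod * y.coeff N =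
      ((D.alpha b).map fun t : ℝ => (D.ℓ0 : ℂ)⁻¹ * ((N - D.ℓ0 : ℤ) : ℂ) + (t : ℂ)).prod *
        y.coeff (N - D.ℓ0) := by
  rw [HahnSeries.ext_iff, funext_iff]
  refine forall_congr' fun N => ?_
  rw [hypergeometricOpPow_coeff, HahnSeries.coeff_zero, sub_eq_zero]

/-- A solution is determined by its coefficients at the exponents of the operator. -/
theorem eq_zero_of_rowOp_eq_zero {b : Fin n → ℤ} {y : LaurentSeries ℂ} (hy : D.rowOp b y = 0)
    (h : ∀ s ∈ Finset.range D.ℓ0 \ D.cancelled b, y.coeff (s : ℤ) = 0) : y = 0 := by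
  rw [rowOp_eq_zero_iff] at hy
  -- Upward induction from the order: away from the exponents the indicial product is nonzero, so
  -- the recursion propagates zeros.
  have key : ∀ (k : ℕ) (N : ℤ), N < y.order + k → y.coeff N = 0 := by
    intro k
    induction k with
    | zero => exact fun N hN => HahnSeries.coeff_eq_zero_of_lt_order (by simpa using hN)
    | succ k ih =>
      intro N hN
      have h1 := hy N
      have hpos := D.ℓ0_pos
      rw [ih (N - D.ℓ0) (by push_cast at hN; omega), mul_zero, mul_eq_zero,
        prod_beta_eq_zero_iff] at h1
      rcases h1 with ⟨s, hs, rfl⟩ | h1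
      · exact h s hs
      · exact h1
  ext N
  exact key (N - y.order + 1).toNat N (by omega)

open Classical in
theorem coeff_row {b b' : Fin n → ℤ} (hb : b ∈ D.B) (hb' : b' ∈ D.B) (N : ℕ) :
    (HahnSeries.ofPowerSeries ℤ ℂ (D.G b' b)).coeff (N : ℤ) =
      if b' = D.frac (b + N • D.a0) then D.rowCoeff b N else 0 := by
  rw [LaurentSeries.coeff_coe_powerSeries, coeff_G hb' (D.B_subset_M hb)]
  rfl

theorem rowOp_row {b b' : Fin n → ℤ} (hb : b ∈ D.B) (hb' : b' ∈ D.B) :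
    D.rowOp b (HahnSeries.ofPowerSeries ℤ ℂ (D.G b' b)) = 0 := by
  classical
  rw [rowOp_eq_zero_iff]
  have hneg : ∀ N : ℤ, N < 0 → (HahnSeries.ofPowerSeries ℤ ℂ (D.G b' b)).coeff N = 0 :=
    fun N hN => by rw [PowerSeries.coeff_coe, if_pos hN]
  intro N
  rcases lt_or_ge N 0 with h | h
  · rw [hneg N h, hneg _ (by have := D.ℓ0_pos; omega), mul_zero, mul_zero]
  obtain ⟨N, rfl⟩ := Int.eq_ofNat_of_zero_le h
  rcases lt_or_ge N D.ℓ0 with h1 | h1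
  -- Initial terms: `N` is either an indicial root or cancelled, and in the latter case the
  -- coefficient vanishes.
  · rw [hneg ((N : ℤ) - D.ℓ0) (by omega), mul_zero, mul_eq_zero, prod_beta_eq_zero_iff,
      coeff_row hb hb']
    by_cases hN : N ∈ D.cancelled b
    · rw [(rowCoeff_eq_zero_iff hb h1).2 hN, ite_self]
      exact Or.inr rfl
    · exact Or.inl ⟨N, by simp [h1, hN], rfl⟩
  · obtain ⟨N, rfl⟩ := Nat.exists_eq_add_of_le' h1
    have e1 : ((N + D.ℓ0 : ℕ) : ℤ) - D.ℓ0 = (N : ℤ) := by push_cast; ring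
    have e2 : D.frac (b + (N + D.ℓ0) • D.a0) = D.frac (b + N • D.a0) :=
      (frac_add_a0_eq_iff (D.B_subset_M hb) _ _).2 (by simp [Nat.ModEq])
    rw [e1, coeff_row hb hb', coeff_row hb hb', e2]
    split_ifs
    · have := rowCoeff_add hb N
      push_cast
      exact this
    · rw [mul_zero, mul_zero]

/-- An entry solves the hypergeometric equation, so it is nonzero exactly when it has a nonzero
coefficient at some exponent. -/
theorem solMatrix_ne_zero_iff {b b' : Fin n → ℤ} (hb : b ∈ D.B) (hb' : b' ∈ D.B) :
    D.solMatrix ⟨b, hb⟩ ⟨b', hb'⟩ ≠ 0 ↔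
      ∃ s ∈ Finset.range D.ℓ0 \ D.cancelled b, D.frac (b + s • D.a0) = b' := by
  classical
  have hbM := D.B_subset_M hb
  constructor
  · intro h
    by_contra! h'
    apply h
    rw [← map_eq_zero_iff _ (HahnSeries.ofPowerSeries_injective (Γ := ℤ) (R := ℂ))]
    refine eq_zero_of_rowOp_eq_zero (rowOp_row hb hb') fun s hs => ?_
    exact (coeff_row hb hb' s).trans (if_neg (h' s hs).symm)
  · rintro ⟨s, hs, rfl⟩ h
    rw [Finset.mem_sdiff, Finset.mem_range] at hs
    apply hs.2
    rw [← rowCoeff_eq_zero_iff hb hs.1]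
    have := coeff_row hb hb' s
    rw [if_pos rfl] at this
    rw [← this, show D.G _ b = 0 from h, map_zero, HahnSeries.coeff_zero]

/-- The nonzero entries of row `b` correspond to the exponents of the hypergeometric operator. -/
def exponentEquiv {b : Fin n → ℤ} (hb : b ∈ D.B) :
    ↥(Finset.range D.ℓ0 \ D.cancelled b) ≃ {b' : D.B // D.solMatrix ⟨b, hb⟩ b' ≠ 0} :=
  Equiv.ofBijective
    (fun s => ⟨⟨D.frac (b + s.1 • D.a0), frac_mem_B (add_nsmul_a0_mem_M (D.B_subset_M hb) s)⟩,
      (solMatrix_ne_zero_iff hb _).2 ⟨s, s.2, rfl⟩⟩) (by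
    constructor
    · rintro ⟨s, hs⟩ ⟨t, ht⟩ h
      simp only [Subtype.mk.injEq] at h
      rw [frac_add_a0_eq_iff (D.B_subset_M hb)] at h
      simp only [Finset.mem_sdiff, Finset.mem_range] at hs ht
      exact Subtype.ext (Nat.ModEq.eq_of_lt_of_lt h hs.1 ht.1)
    · rintro ⟨⟨b', hb'⟩, h⟩
      obtain ⟨s, hs, rfl⟩ := (solMatrix_ne_zero_iff hb hb').1 h
      exact ⟨⟨s, hs⟩, rfl⟩)

theorem rowEntries_exponentEquiv {b : Fin n → ℤ} (hb : b ∈ D.B)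
    (s : ↥(Finset.range D.ℓ0 \ D.cancelled b)) : D.rowEntries ⟨b, hb⟩ (exponentEquiv hb s) =
      HahnSeries.ofPowerSeries ℤ ℂ (D.G (D.frac (b + s.1 • D.a0)) b) := rfl

/-- Each residue class modulo `ℓ0` belongs to one column, so the matrix of coefficients at the
exponents is diagonal; both independence and spanning rest on this. -/
theorem rowEntries_coeff {b : Fin n → ℤ} (hb : b ∈ D.B)
    (s t : ↥(Finset.range D.ℓ0 \ D.cancelled b)) :
    (D.rowEntries ⟨b, hb⟩ (exponentEquiv hb s)).coeff (t.1 : ℤ) =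
      if s = t then D.rowCoeff b t else 0 := by
  classical
  have hM := add_nsmul_a0_mem_M (D.B_subset_M hb) s.1
  rw [rowEntries_exponentEquiv, coeff_row hb (frac_mem_B hM)]
  refine if_congr ?_ rfl rfl
  rw [← (exponentEquiv hb).injective.eq_iff, Subtype.ext_iff, Subtype.ext_iff]
  rfl

theorem rowCoeff_ne_zero {b : Fin n → ℤ} (hb : b ∈ D.B)
    (s : ↥(Finset.range D.ℓ0 \ D.cancelled b)) : D.rowCoeff b s ≠ 0 := by
  obtain ⟨s, hs⟩ := s
  rw [Finset.mem_sdiff, Finset.mem_range] at hs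
  rw [Ne, rowCoeff_eq_zero_iff hb hs.1]
  exact hs.2

theorem linearIndependent_rowEntries {b : Fin n → ℤ} (hb : b ∈ D.B) :
    LinearIndependent ℂ (D.rowEntries ⟨b, hb⟩) := by
  rw [← linearIndependent_equiv (exponentEquiv hb), Fintype.linearIndependent_iff]
  intro c hc t
  have h := congrArg (fun y => HahnSeries.coeff y (t.1 : ℤ)) hc
  simpa [HahnSeries.coeff_sum, rowEntries_coeff, rowCoeff_ne_zero hb t] using h

theorem rowOp_eq_zero_iff_mem_span {b : Fin n → ℤ} (hb : b ∈ D.B) (y : LaurentSeries ℂ) :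
    D.rowOp b y = 0 ↔ y ∈ Submodule.span ℂ (Set.range (D.rowEntries ⟨b, hb⟩)) := by
  constructor
  · intro hy
    -- The combination of entries that agrees with `y` at every exponent; the difference is a
    -- solution vanishing at all exponents.
    set z : LaurentSeries ℂ := ∑ s, (y.coeff (s.1 : ℤ) / D.rowCoeff b s.1) •
      D.rowEntries ⟨b, hb⟩ (exponentEquiv hb s) with hz
    have hz1 : z ∈ Submodule.span ℂ (Set.range (D.rowEntries ⟨b, hb⟩)) :=
      sum_mem fun s _ => Submodule.smul_mem _ _ (Submodule.subset_span ⟨_, rfl⟩)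
    have hz2 : D.rowOp b z = 0 := by
      rw [hz, map_sum]
      refine Finset.sum_eq_zero fun s _ => ?_
      rw [map_smul, rowEntries_exponentEquiv,
        rowOp_row hb (frac_mem_B (add_nsmul_a0_mem_M (D.B_subset_M hb) _)), smul_zero]
    have h := eq_zero_of_rowOp_eq_zero (D := D) (b := b) (y := y - z)
      (by rw [map_sub, hy, hz2, sub_zero]) fun t ht => by
        have := rowCoeff_ne_zero hb ⟨t, ht⟩
        have e : z.coeff (t : ℤ) = y.coeff (t : ℤ) := by
          rw [hz, HahnSeries.coeff_sum]
          simp only [HahnSeries.coeff_smul]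
          rw [Finset.sum_eq_single ⟨t, ht⟩]
          · rw [rowEntries_coeff hb ⟨t, ht⟩ ⟨t, ht⟩, if_pos rfl, smul_eq_mul, div_mul_cancel₀ _ this]
          · intro s _ hs
            rw [rowEntries_coeff hb s ⟨t, ht⟩, if_neg hs, smul_zero]
          · simp
        rw [HahnSeries.coeff_sub, e, sub_self]
    rwa [sub_eq_zero.1 h]
  · intro hy
    have h : Submodule.span ℂ (Set.range (D.rowEntries ⟨b, hb⟩)) ≤ LinearMap.ker (D.rowOp b) := by
      rw [Submodule.span_le]
      rintro _ ⟨b', rfl⟩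
      exact rowOp_row hb b'.1.2
    exact h hy

/-! ### Counting the nonzero entries -/

theorem card_nonzero_entries {b : Fin n → ℤ} (hb : b ∈ D.B) :
    Nat.card {b' : D.B // D.solMatrix ⟨b, hb⟩ b' ≠ 0} =
      (Finset.range D.ℓ0 \ D.cancelled b).card := by
  rw [← Nat.card_congr (exponentEquiv hb), Nat.card_eq_fintype_card, Fintype.card_coe]

open Classical in
theorem R_eq_card {k : D.Coset} {b : Fin n → ℤ} (hb : b ∈ D.Bk k) : D.R k =
    ((Finset.range D.ℓ0).filter fun s => D.IsInterior (D.frac (b + s • D.a0))).card := by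
  have hbM := D.Bk_subset_Mk k hb
  rw [R, ← Set.ncard_coe_finset, ← Set.InjOn.ncard_image
    (f := fun s : ℕ => D.frac (b + s • D.a0))]
  · congr 1
    ext u
    simp only [Set.mem_ofPred_eq, Set.mem_image, Finset.coe_filter, Finset.mem_range]
    constructor
    · rintro ⟨hu, hi⟩
      obtain ⟨s, hs, rfl⟩ := exists_frac_add_a0_eq hbM hu
      exact ⟨s, ⟨hs, hi⟩, rfl⟩
    · rintro ⟨s, ⟨-, hi⟩, rfl⟩
      exact ⟨frac_mem_Bk (add_nsmul_a0_mem_Mk hbM s), hi⟩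
  · intro s hs t ht h
    simp only [Finset.coe_filter, Finset.mem_range, Set.mem_ofPred_eq] at hs ht
    exact Nat.ModEq.eq_of_lt_of_lt ((frac_add_a0_eq_iff hbM.1 s t).1 h) hs.1 ht.1

/-- The `s` that survive are those for which `b + s a0` reduces to an interior point or to `b`; here
the second case is contained in the first. -/
theorem card_exponents_of_isInterior {k : D.Coset} {b : Fin n → ℤ} (hb : b ∈ D.Bk k)
    (hi : D.IsInterior b) : (Finset.range D.ℓ0 \ D.cancelled b).card = D.R k := by
  classical
  rw [R_eq_card hb]
  congr 1
  ext s
  rw [Finset.mem_sdiff, Finset.mem_filter, mem_cancelled_iff hb.1]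
  refine and_congr_right fun hs => ?_
  by_cases h : D.frac (b + s • D.a0) = b
  · rw [h]; tauto
  · have := Finset.mem_range.1 hs
    tauto

/-- The additional exponent is `s = 0`, where `b + s a0` reduces to the boundary point `b` itself.
-/
theorem card_exponents_of_not_isInterior {k : D.Coset} {b : Fin n → ℤ} (hb : b ∈ D.Bk k)
    (hi : ¬ D.IsInterior b) : (Finset.range D.ℓ0 \ D.cancelled b).card = D.R k + 1 := by
  classical
  rw [R_eq_card hb, ← Finset.card_insert_of_notMem (a := 0)]
  · congr 1
    ext s
    rw [Finset.mem_sdiff, Finset.mem_insert, Finset.mem_filter, mem_cancelled_iff hb.1,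
      Finset.mem_range]
    constructor
    · rintro ⟨hs, h⟩
      rw [Ne, frac_add_a0_eq_self_iff hb.1 hs] at h
      tauto
    · rintro (rfl | ⟨hs, h⟩)
      · exact ⟨D.ℓ0_pos, fun h => h.2.2 ((frac_add_a0_eq_self_iff hb.1 D.ℓ0_pos).2 rfl)⟩
      · exact ⟨hs, fun h' => h'.2.1 h⟩
  · simp [frac_eq_self hb.1, hi]

/-! ### Transfer to `𝒲'_k` -/

theorem xi_smul_complex {b : Fin n → ℤ} (hb : b ∈ D.B) {k : D.Coset} (c : ℂ) (w : D.W k) :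
    D.xi hb k (c • w) = c • D.xi hb k w := by
  rw [← algebraMap_smul K c w, map_smul, Algebra.smul_def, ← HahnSeries.C_mul_eq_smul,
    ← toLaurent_C]
  rfl

theorem xi_actW {b : Fin n → ℤ} (hb : b ∈ D.B) {k : D.Coset} (c : ℕ →₀ K) (w : D.W k) :
    D.xi hb k (D.actW k c w) = actL c (D.xi hb k w) := by
  have h : ∀ (i : ℕ) (w : D.W k), D.xi hb k ((D.DlamW k ^ i) w) = (delL ^ i) (D.xi hb k w) := by
    intro i
    induction i with
    | zero => simp
    | succ i ih =>
      intro w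
      rw [pow_succ, pow_succ, Module.End.mul_apply, Module.End.mul_apply, ih, xi_DlamW]
  rw [actW, actL, Finsupp.sum, Finsupp.sum, map_sum]
  refine Finset.sum_congr rfl fun i _ => ?_
  rw [map_smul, h, Algebra.smul_def]
  rfl

theorem row_mem_span {b b' : Fin n → ℤ} (hb : b ∈ D.B) (hb' : b' ∈ D.B) :
    HahnSeries.ofPowerSeries ℤ ℂ (D.G b' b) ∈
      Submodule.span ℂ (Set.range (D.rowEntries ⟨b, hb⟩)) :=
  (rowOp_eq_zero_iff_mem_span hb _).1 (rowOp_row hb hb')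

end Datum
end Delsarte
end

theorem theorem8p2 {n m : ℕ} (D : Delsarte.Datum n m) (k : D.Coset) (b : Fin n → ℤ)
    (hb : b ∈ D.Bk k) :
    -- the nonzero entries of row `b` are linearly independent over `ℂ`, and their number is the
    -- order of the hypergeometric operator
    (LinearIndependent ℂ (D.rowEntries ⟨b, hb.1⟩) ∧
      Finite {b' : D.B // D.solMatrix ⟨b, hb.1⟩ b' ≠ 0} ∧
      (D.IsInterior b → Nat.card {b' : D.B // D.solMatrix ⟨b, hb.1⟩ b' ≠ 0} = D.R k) ∧
      (¬ D.IsInterior b → Nat.card {b' : D.B // D.solMatrix ⟨b, hb.1⟩ b' ≠ 0} = D.R k + 1) ∧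
      (D.beta b).card = Nat.card {b' : D.B // D.solMatrix ⟨b, hb.1⟩ b' ≠ 0} ∧
      (D.alpha b).card = Nat.card {b' : D.B // D.solMatrix ⟨b, hb.1⟩ b' ≠ 0}) ∧
    -- they span the space of solutions of the hypergeometric equation in `λ^ℓ0`
    (∀ y : LaurentSeries ℂ,
      Delsarte.hypergeometricOpPow (E := Module.End ℂ (LaurentSeries ℂ)) D.ℓ0
          Delsarte.lamL Delsarte.delL (D.alpha b) (D.beta b) y = 0 ↔
        y ∈ Submodule.span ℂ (Set.range (D.rowEntries ⟨b, hb.1⟩))) ∧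
    -- `x^b` satisfies that equation in `𝒲'_k`
    Delsarte.hypergeometricOpPow (E := Module.End ℂ (D.W k)) D.ℓ0
        (D.lamW k) (D.DlamW k) (D.alpha b) (D.beta b) (D.mono k b (D.Bk_subset_Mk k hb)) = 0 ∧
    -- `x^b` satisfies every linear differential equation over `ℂ(λ)` whose solution space in
    -- `ℂ((λ))` is spanned by the nonzero entries of row `b`
    (∀ c : ℕ →₀ Delsarte.K,
      (∀ y : LaurentSeries ℂ, Delsarte.actL c y = 0 ↔
        y ∈ Submodule.span ℂ (Set.range (D.rowEntries ⟨b, hb.1⟩))) →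
      D.actW k c (D.mono k b (D.Bk_subset_Mk k hb)) = 0) := by
  open Delsarte.Datum in
  refine ⟨⟨linearIndependent_rowEntries hb.1, Finite.of_equiv _ (exponentEquiv hb.1), fun hi => ?_,
    fun hi => ?_, ?_, ?_⟩, rowOp_eq_zero_iff_mem_span hb.1, ?_, fun c hc => ?_⟩
  · rw [card_nonzero_entries hb.1, card_exponents_of_isInterior hb hi]
  · rw [card_nonzero_entries hb.1, card_exponents_of_not_isInterior hb hi]
  · rw [card_nonzero_entries hb.1, card_beta]
  · rw [card_nonzero_entries hb.1, card_alpha hb.1]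
  -- Under `ξ_{b'}` the claim becomes that the operator kills the `(b, b')`-entry, whether or not
  -- that entry is zero.
  · refine eq_zero_of_xi_eq_zero fun b' hb' => ?_
    -- `ξ_{b'}` is regarded as a `ℂ`-linear map because `∂_λ` is only `ℂ`-linear.
    let φ : D.W k →ₗ[ℂ] LaurentSeries ℂ :=
      { toFun := D.xi hb'.1 k
        map_add' := map_add _
        map_smul' := xi_smul_complex hb'.1 }
    refine (Delsarte.map_hypergeometricOpPow φ (xi_lamW hb'.1) (xi_DlamW hb'.1) _ _ _ _).trans ?_
    change D.rowOp b (D.xi hb'.1 k _) = 0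
    rw [xi_mono, rowOp_row hb.1 hb'.1]
  · refine eq_zero_of_xi_eq_zero fun b' hb' => ?_
    rw [xi_actW, xi_mono, hc]
    exact row_mem_span hb.1 hb'.1
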